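/- Let $M\ge 0$, let $W=(w_0,w_1,\dots,w_{M+1})$ be a sequence of non-negative integers with $w_0=w_{M+1}=0$, and let $\kappa\ge 1$ be a finite cardinal. For finite sequences write $|A|$ for the length of $A$, $A\preceq B$ if $A$ is an initial segment of $B$, and $A\wedge B$ for the longest common initial segment of $A$ and $B$. The $\kappa$-branching bundle graph $T_{W,\kappa}$ has as vertices the pairs $(r,A)$ with $r\in\{0,\dots,M+1\}$ and $A\in\{0,\dots,\kappa-1\}^{w_r}$; vertices $(r,A)$ and $(s,B)$ are adjacent if $|r-s|=1$ and $A\preceq B$ or $B\preceq A$. Let $d$ be its shortest-path metric. For vertices $u=(r,A)$, $v=(s,B)$ write $u\Updownarrow v$ if there is an integer $t$ between $r$ and $s$ (inclusive) with $w_t\le|A\wedge B|$. For $r\in\{0,\dots,M+1\}$ put $x(r,0)=0$, $y(r,0)=M+1$ and, for $i\ge1$, $$x(r,i)=\max\{t\in\{0,\dots,M+1\}: w_t<i,\ t\le r\},\qquad y(r,i)=\min\{t\in\{0,\dots,M+1\}: w_t<i,\ t\ge r\}.$$ Let $p_W$ be the least positive integer $p$ such that for all $r\in\{0,\dots,M+1\}$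 and all integers $i\ge0$: $x(r,i+p)\ge\frac{x(r,i)+y(r,i)}2$ whenever $r\ge\frac{x(r,i)+y(r,i)}2$, and $y(r,i+p)\le\frac{x(r,i)+y(r,i)}2$ whenever $r\le\frac{x(r,i)+y(r,i)}2$. Let $X$ be a real Banach space with an equal-signs-additive (ESA) basis, that is, a Schauder basis $(e_n)_{n=1}^\infty$ such that for every finitely supported real sequence $(a_n)_{n=1}^\infty$ and every $k\ge 1$ with $a_ka_{k+1}\ge0$, $$\Big\|\sum_{n<k}a_ne_n+(a_k+a_{k+1})e_k+\sum_{n\ge k+2}a_ne_n\Big\|=\Big\|\sum_{n}a_ne_n\Big\|.$$ **Theorem.** One has $p_W\le\max W+1$, and there is a bi-Lipschitz embedding $\psi\colon T_{W,\kappa}\to X$ such that for all vertices $u,v$ of $T_{W,\kappa}$ $$\frac1{2^{2p_W+1}}\,d(u,v)\le\|\psi(u)-\psi(v)\|\le d(u,v),$$ and $\|\psi(u)-\psi(v)\|=d(u,v)$ whenever $u\Updownarrow v$. -/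

import Mathlib

namespace BundleGraph

/-! ### Finite sequences -/

/-- The longest common initial segment `A ∧ B` of two finite sequences. -/
def meet {α : Type*} [DecidableEq α] : List α → List α → List α
  | a :: A, b :: B => if a = b then a :: meet A B else []
  | _, _ => []

theorem meet_prefix_left {α : Type*} [DecidableEq α] :
    ∀ A B : List α, meet A B <+: A
  | [], _ => by simp [meet]
  | _ :: _, [] => by simp [meet]
  | a :: A, b :: B => by
    by_cases h : a = b
    · simpa [meet, h] using meet_prefix_left A B
    · simp [meet, h]

theorem meet_prefix_right {α : Type*} [DecidableEq α] :
    ∀ A B : List α, meet A B <+: B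
  | [], _ => by simp [meet]
  | _ :: _, [] => by simp [meet]
  | a :: A, b :: B => by
    by_cases h : a = b
    · simpa [meet, h] using meet_prefix_right A B
    · simp [meet, h]

theorem prefix_meet {α : Type*} [DecidableEq α] :
    ∀ C A B : List α, C <+: A → C <+: B → C <+: meet A B
  | [], _, _, _, _ => by simp
  | _ :: _, [], _, h, _ => by simp at h
  | _ :: _, _ :: _, [], _, h => by simp at h
  | c :: C, a :: A, b :: B, h₁, h₂ => by
    rw [List.cons_prefix_cons] at h₁ h₂
    obtain ⟨rfl, h₁⟩ := h₁
    obtain ⟨rfl, h₂⟩ := h₂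
    simpa [meet] using prefix_meet C A B h₁ h₂

/-! ### Bundle graphs -/

/-- The vertices of `T_{W,κ}`, where `W = (w_0, …, w_{M+1})`: pairs `(r, A)` with
`r ∈ {0, …, M+1}` and `A` a sequence of length `w_r` in `{0, …, κ-1}`. -/
@[ext]
structure Vertex {M : ℕ} (W : Fin (M + 2) → ℕ) (κ : ℕ) where
  /-- the height `r` -/
  height : Fin (M + 2)
  /-- the sequence `A` -/
  label : List (Fin κ)
  length_label : label.length = W height

/-- The `κ`-branching bundle graph `T_{W,κ}`: `(r, A)` and `(s, B)` are joined by an edge when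
`|r - s| = 1` and one of `A`, `B` is an initial segment of the other. -/
def graph {M : ℕ} (W : Fin (M + 2) → ℕ) (κ : ℕ) : SimpleGraph (Vertex W κ) where
  Adj u v :=
    ((u.height : ℕ) + 1 = v.height ∨ (v.height : ℕ) + 1 = u.height) ∧
      (u.label <+: v.label ∨ v.label <+: u.label)
  symm := ⟨fun _ _ h => ⟨h.1.symm, h.2.symm⟩⟩
  loopless := ⟨fun _ h => by rcases h.1 with h | h <;> omega⟩

/-- The relation `u ⇕ v` for `u = (r, A)`, `v = (s, B)`: there is `t` between `r` and `s`
(inclusive) with `w_t ≤ |A ∧ B|`. -/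
def UpDown {M : ℕ} {W : Fin (M + 2) → ℕ} {κ : ℕ} (u v : Vertex W κ) : Prop :=
  ∃ t : Fin (M + 2), min u.height v.height ≤ t ∧ t ≤ max u.height v.height ∧
    W t ≤ (meet u.label v.label).length

/-! ### The parameter `p_W` -/

/-- `x(r, i)`: equal to `0` if `i = 0`, and otherwise the largest `t ≤ r` with `w_t < i`
(which exists as soon as `w_0 = 0`). -/
noncomputable def x {M : ℕ} (W : Fin (M + 2) → ℕ) (r : Fin (M + 2)) (i : ℕ) : Fin (M + 2) :=
  if i = 0 then 0 else (Finset.univ.filter fun t => W t < i ∧ t ≤ r).sup id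

/-- `y(r, i)`: equal to `M + 1` if `i = 0`, and otherwise the smallest `t ≥ r` with `w_t < i`
(which exists as soon as `w_{M+1} = 0`). -/
noncomputable def y {M : ℕ} (W : Fin (M + 2) → ℕ) (r : Fin (M + 2)) (i : ℕ) : Fin (M + 2) :=
  if i = 0 then Fin.last (M + 1) else (Finset.univ.filter fun t => W t < i ∧ r ≤ t).inf id

/-- The condition on `p` whose least solution is `p_W`: for all `r` and `i`,
`x(r, i + p) ≥ (x(r, i) + y(r, i)) / 2` whenever `r ≥ (x(r, i) + y(r, i)) / 2`, and
`y(r, i + p) ≤ (x(r, i) + y(r, i)) / 2` whenever `r ≤ (x(r, i) + y(r, i)) / 2`. -/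
def Admissible {M : ℕ} (W : Fin (M + 2) → ℕ) (p : ℕ) : Prop :=
  ∀ (r : Fin (M + 2)) (i : ℕ),
    (((x W r i : ℕ) + (y W r i : ℕ) : ℝ) / 2 ≤ ((r : ℕ) : ℝ) →
      ((x W r i : ℕ) + (y W r i : ℕ) : ℝ) / 2 ≤ ((x W r (i + p) : ℕ) : ℝ)) ∧
    (((r : ℕ) : ℝ) ≤ ((x W r i : ℕ) + (y W r i : ℕ) : ℝ) / 2 →
      ((y W r (i + p) : ℕ) : ℝ) ≤ ((x W r i : ℕ) + (y W r i : ℕ) : ℝ) / 2)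

/-- `p_W`, the least positive integer `p` that satisfies `Admissible W p`. -/
noncomputable def pParam {M : ℕ} (W : Fin (M + 2) → ℕ) : ℕ :=
  sInf {p : ℕ | 0 < p ∧ Admissible W p}

/-- `max W`. -/
def maxDepth {M : ℕ} (W : Fin (M + 2) → ℕ) : ℕ :=
  Finset.univ.sup W

/-- The set whose infimum defines `pParam W` is never empty. -/
theorem admissible_nonempty {M : ℕ} (W : Fin (M + 2) → ℕ) :
    {p : ℕ | 0 < p ∧ Admissible W p}.Nonempty := by
  refine ⟨maxDepth W + 1, Nat.succ_pos _, fun r i => ?_⟩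
  have hr : W r < i + (maxDepth W + 1) := by
    have : W r ≤ maxDepth W := Finset.le_sup (f := W) (Finset.mem_univ r)
    omega
  have hx : r ≤ x W r (i + (maxDepth W + 1)) := by
    rw [x, if_neg (by omega)]
    exact Finset.le_sup (f := id) (by simp [hr])
  have hy : y W r (i + (maxDepth W + 1)) ≤ r := by
    rw [y, if_neg (by omega)]
    exact Finset.inf_le (f := id) (by simp [hr])
  have hx' : ((r : ℕ) : ℝ) ≤ ((x W r (i + (maxDepth W + 1)) : ℕ) : ℝ) := by exact_mod_cast hx
  have hy' : ((y W r (i + (maxDepth W + 1)) : ℕ) : ℝ) ≤ ((r : ℕ) : ℝ) := by exact_mod_cast hy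
  exact ⟨fun h => h.trans hx', fun h => hy'.trans h⟩

/-! ### Equal-signs-additive sequences -/

/-- A sequence `(e_n)` is equal-signs-additive if for every finitely supported real sequence
`(a_n)` and every `k` with `a_k a_{k+1} ≥ 0`,
`‖∑_{n < k} a_n e_n + (a_k + a_{k+1}) e_k + ∑_{n ≥ k+2} a_n e_n‖ = ‖∑_n a_n e_n‖`. -/
def IsESA {X : Type*} [NormedAddCommGroup X] [NormedSpace ℝ X] (e : ℕ → X) : Prop :=
  ∀ (a : ℕ →₀ ℝ) (k : ℕ), 0 ≤ a k * a (k + 1) →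
    ‖(∑ n ∈ Finset.range k, a n • e n) + (a k + a (k + 1)) • e k +
        ∑ n ∈ a.support with k + 2 ≤ n, a n • e n‖ =
      ‖∑ n ∈ a.support, a n • e n‖

end BundleGraph

/-! To a vertex of height `r` a random `r`-element subset of `{0, …, M}` is attached, one for each
choice `ω` of a bit per word, so that the sets are nested whenever `u ⇕ v`. A block is the indicator
of this set followed by `-r`; it sums to zero. The embedding concatenates the blocks over all `ω`
and divides by the norm of `(1, -1, …, 1, -1)` with one pair per `ω`.

In an ESA sequence, merging adjacent coefficients preserves the norm if their signs agree
(`listNorm_sum_eq`) and never increases it (`listNorm_sum_le`). If `u ⇕ v`, every difference block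
collapses to `(q, -q)` with `q` the difference of heights, so the norm is exactly `|q|`, which is
the distance. In particular edges have image length 1, whence the upper bound.

Otherwise put `m = |A ∧ B|`. Both heights lie strictly inside one gap `[a, b]` between neighbouring
heights of depth at most `m`, and beyond level `m` the two vertices read bits at different words.
For a proportion at least `2^(-2p)` of the `ω`, the levels `m + 1, …, m + p` fill the gap upwards
for `u` and downwards for `v`. Admissibility of `p` says that these levels settle how the sets meet
the two halves of the gap, so some initial segment of `{0, …, M}` contains exactly `q` more points
of one set than of the other (`exists_card_filter_lt_eq`). Such blocks merge to `(q, -q)`, the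
others to `0`, and subadditivity of the norms of alternating vectors costs a factor `2^(2p)`. Walks
through height `a` or `b` show `d ≤ 2q` for `u, v` in a suitable order, which gives the last factor
2. -/

namespace BundleGraph

/-! ### Lists of coefficients and equal-signs-additive sequences -/

section ListVec

variable {X : Type*} [NormedAddCommGroup X] [NormedSpace ℝ X] {E : ℕ → X}

/-- The vector `∑ i, l_i • E (k + i)` with coefficients listed in `l`. -/
def listVec (E : ℕ → X) : ℕ → List ℝ → X
  | _, [] => 0
  | k, a :: l => a • E k + listVec E (k + 1) l

/-- The norm of the vector with coefficients listed in `l`. -/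
def listNorm (E : ℕ → X) (l : List ℝ) : ℝ := ‖listVec E 0 l‖

theorem listVec_append (k : ℕ) (l₁ l₂ : List ℝ) :
    listVec E k (l₁ ++ l₂) = listVec E k l₁ + listVec E (k + l₁.length) l₂ := by
  induction l₁ generalizing k with
  | nil => simp [listVec]
  | cons a l ih =>
    simp only [List.cons_append, listVec, ih, List.length_cons, add_assoc]
    rw [add_comm l.length 1]

theorem listVec_map_mul (c : ℝ) (k : ℕ) (l : List ℝ) :
    listVec E k (l.map (c * ·)) = c • listVec E k l := by
  induction l generalizing k with
  | nil => simp [listVec]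
  | cons a l ih => simp [listVec, ih, mul_smul]

theorem listVec_map_sub {ι : Type*} (f g : ι → ℝ) (k : ℕ) (l : List ι) :
    listVec E k (l.map f) - listVec E k (l.map g) = listVec E k (l.map fun i => f i - g i) := by
  induction l generalizing k with
  | nil => simp [listVec]
  | cons a l ih =>
    simp only [List.map_cons, listVec, ← ih, sub_smul]
    abel

theorem listVec_eq_sum (k : ℕ) (l : List ℝ) :
    listVec E k l = ∑ i ∈ Finset.range l.length, l.getD i 0 • E (k + i) := by
  induction l generalizing k with
  | nil => simp [listVec]
  | cons a l ih =>
    rw [listVec, ih, List.length_cons, Finset.sum_range_succ']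
    simp only [List.getD_cons_succ, List.getD_cons_zero, add_zero]
    rw [add_comm]
    congr 1
    exact Finset.sum_congr rfl fun i _ => by rw [add_assoc, add_comm 1 i]

theorem listNorm_append_zero (l : List ℝ) : listNorm E (l ++ [0]) = listNorm E l := by
  simp [listNorm, listVec_append, listVec]

namespace IsESA

variable (hE : IsESA E)
include hE

/-- Transfers the defining identity from finitely supported sequences to lists; the vacated position
survives as an explicit zero. -/
theorem listNorm_merge_zero (l₁ l₂ : List ℝ) (a b : ℝ) (hab : 0 ≤ a * b) :
    listNorm E (l₁ ++ a :: b :: l₂) = listNorm E (l₁ ++ (a + b) :: 0 :: l₂) := by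
  set l := l₁ ++ a :: b :: l₂ with hl
  set k := l₁.length
  let f : ℕ →₀ ℝ := Finsupp.onFinset (Finset.range l.length) (fun i => l.getD i 0) (by
    intro i hi
    by_contra h
    exact hi (List.getD_eq_default _ _ (by simpa using h)))
  have hf : ∀ i, f i = l.getD i 0 := fun i => rfl
  have hfk : f k = a := by simp [hf, hl, k]
  have hfk1 : f (k + 1) = b := by simp [hf, hl, k]
  have hlt : ∀ i < k, f i = l₁.getD i 0 := fun i hi => by
    rw [hf, hl, List.getD_append _ _ _ _ hi]
  have hge : ∀ i, f (k + 2 + i) = l₂.getD i 0 := fun i => by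
    rw [hf, hl, List.getD_append_right _ _ _ _ (by omega)]
    rw [show k + 2 + i - l₁.length = i + 1 + 1 by omega]
    simp
  have hsupp : f.support ⊆ Finset.range l.length := Finsupp.support_onFinset_subset
  have h := hE f k (by rw [hfk, hfk1]; exact hab)
  rw [hfk, hfk1] at h
  have h₁ : ∑ n ∈ f.support, f n • E n = listVec E 0 l := by
    rw [listVec_eq_sum]
    simp only [zero_add, ← hf]
    exact Finset.sum_subset hsupp fun i _ hi => by
      rw [Finsupp.notMem_support_iff.1 hi, zero_smul]
  have h₂ : ∑ n ∈ f.support with k + 2 ≤ n, f n • E n = listVec E (k + 2) l₂ := by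
    rw [listVec_eq_sum]
    have : ∑ n ∈ f.support with k + 2 ≤ n, f n • E n =
        ∑ n ∈ (Finset.range l.length) with k + 2 ≤ n, f n • E n := by
      refine Finset.sum_subset (Finset.filter_subset_filter _ hsupp) fun i hi hi' => ?_
      have : i ∉ f.support := fun hs =>
        hi' (Finset.mem_filter.2 ⟨hs, (Finset.mem_filter.1 hi).2⟩)
      rw [Finsupp.notMem_support_iff.1 this, zero_smul]
    rw [this]
    refine (Finset.sum_bij (fun i _ => k + 2 + i) ?_ ?_ ?_ ?_).symm
    · intro i hi
      simp [hl, k] at hi ⊢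
      omega
    · intro i _ j _ hij
      omega
    · intro i hi
      simp [hl] at hi
      exact ⟨i - (k + 2), by simp; omega, by omega⟩
    · intro i _
      rw [hge]
  have h₃ : ∑ n ∈ Finset.range k, f n • E n = listVec E 0 l₁ := by
    rw [listVec_eq_sum]
    exact Finset.sum_congr rfl fun i hi => by rw [hlt i (Finset.mem_range.1 hi), zero_add]
  rw [h₁, h₂, h₃] at h
  rw [listNorm, listNorm, ← h, listVec_append]
  simp only [listVec, zero_smul, zero_add, add_assoc]
  rfl

/-- The merging identity turns `0, b` into `b, 0`, so a zero travels to the end of the list, where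
it is harmless. -/
theorem listNorm_insert_zero (l₁ l₂ : List ℝ) :
    listNorm E (l₁ ++ 0 :: l₂) = listNorm E (l₁ ++ l₂) := by
  induction l₂ generalizing l₁ with
  | nil => simpa using listNorm_append_zero l₁
  | cons b l ih =>
    rw [hE.listNorm_merge_zero _ _ _ _ (by simp), zero_add]
    simpa using ih (l₁ ++ [b])

theorem listNorm_merge (l₁ l₂ : List ℝ) (a b : ℝ) (hab : 0 ≤ a * b) :
    listNorm E (l₁ ++ a :: b :: l₂) = listNorm E (l₁ ++ (a + b) :: l₂) := by
  rw [hE.listNorm_merge_zero _ _ _ _ hab]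
  simpa using hE.listNorm_insert_zero (l₁ ++ [a + b]) l₂

/-- The three entries are the average of `a, b, 0` and `0, a, b`, which both have the norm of `a,
b`. -/
theorem listNorm_three_le (l₁ l₂ : List ℝ) (a b : ℝ) :
    listNorm E (l₁ ++ (a / 2) :: ((a + b) / 2) :: (b / 2) :: l₂) ≤
      listNorm E (l₁ ++ a :: b :: l₂) := by
  have h₁ : listNorm E (l₁ ++ a :: b :: 0 :: l₂) = listNorm E (l₁ ++ a :: b :: l₂) := by
    simpa using hE.listNorm_insert_zero (l₁ ++ [a, b]) l₂
  have h₂ : listNorm E (l₁ ++ 0 :: a :: b :: l₂) = listNorm E (l₁ ++ a :: b :: l₂) :=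
    hE.listNorm_insert_zero _ _
  have h₃ : (2 : ℝ) • listVec E 0 (l₁ ++ (a / 2) :: ((a + b) / 2) :: (b / 2) :: l₂) =
      listVec E 0 (l₁ ++ a :: b :: 0 :: l₂) + listVec E 0 (l₁ ++ 0 :: a :: b :: l₂) := by
    simp only [listVec_append, listVec]
    module
  have h₄ := norm_add_le (listVec E 0 (l₁ ++ a :: b :: 0 :: l₂))
    (listVec E 0 (l₁ ++ 0 :: a :: b :: l₂))
  rw [← h₃, norm_smul] at h₄
  simp only [listNorm] at *
  rw [h₁, h₂] at h₄
  norm_num at h₄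
  linarith

/-- Under the sign condition the first two of the three averaged entries merge, so half of `b` moves
into `a`. -/
theorem listNorm_halve_left (l₁ l₂ : List ℝ) (a b : ℝ) (h : 0 ≤ a * (a + b)) :
    listNorm E (l₁ ++ (a + b / 2) :: (b / 2) :: l₂) ≤ listNorm E (l₁ ++ a :: b :: l₂) := by
  have := hE.listNorm_three_le l₁ l₂ a b
  rwa [hE.listNorm_merge _ _ _ _ (by nlinarith), show a / 2 + (a + b) / 2 = a + b / 2 by ring]
    at this

theorem listNorm_halve_right (l₁ l₂ : List ℝ) (a b : ℝ) (h : 0 ≤ b * (a + b)) :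
    listNorm E (l₁ ++ (a / 2) :: (b + a / 2) :: l₂) ≤ listNorm E (l₁ ++ a :: b :: l₂) := by
  have := hE.listNorm_three_le l₁ l₂ a b
  have h' := hE.listNorm_merge (l₁ ++ [a / 2]) l₂ ((a + b) / 2) (b / 2) (by nlinarith)
  simp only [List.append_assoc, List.cons_append, List.nil_append] at h'
  rwa [h', show (a + b) / 2 + b / 2 = b + a / 2 by ring] at this

/-- Merging two adjacent coefficients does not increase the norm. -/
theorem listNorm_merge_le (l₁ l₂ : List ℝ) (a b : ℝ) :
    listNorm E (l₁ ++ (a + b) :: l₂) ≤ listNorm E (l₁ ++ a :: b :: l₂) := by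
  have h0 : ∀ c : ℝ, Filter.Tendsto (fun n : ℕ => c * (1 / 2 : ℝ) ^ n) Filter.atTop (nhds 0) :=
    fun c => by
      simpa using (tendsto_pow_atTop_nhds_zero_of_lt_one (r := (1 / 2 : ℝ))
        (by norm_num) (by norm_num)).const_mul c
  have hpow : ∀ n : ℕ, (1 / 2 : ℝ) ^ n ≤ 1 := fun n => pow_le_one₀ (by norm_num) (by norm_num)
  -- `a(a+b)` and `b(a+b)` add up to a square, so one of them is nonnegative. The corresponding
  -- entry absorbs the other by repeated halving, and the limit is `a + b` next to a zero.
  rcases le_total 0 (a * (a + b)) with h | h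
  · have hc : Continuous fun t : ℝ => listNorm E (l₁ ++ (a + b - t) :: t :: l₂) := by
      simp only [listNorm, listVec_append, listVec]
      fun_prop
    have hlim := (hc.tendsto 0).comp (h0 b)
    have hz : listNorm E (l₁ ++ (a + b - 0) :: 0 :: l₂) = listNorm E (l₁ ++ (a + b) :: l₂) := by
      simpa using hE.listNorm_insert_zero (l₁ ++ [a + b]) l₂
    rw [hz] at hlim
    refine le_of_tendsto' hlim fun n => ?_
    induction n with
    | zero => simp
    | succ n ih =>
      refine le_trans (le_of_eq ?_) ((hE.listNorm_halve_left l₁ l₂ (a + b - b * (1 / 2) ^ n)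
        (b * (1 / 2) ^ n) ?_).trans ih)
      · simp only [Function.comp]
        ring_nf
      -- The sign condition persists because, with `t = 2^(-n)`, the first entry `a + b - tb` is the
      -- convex combination `(1 - t)(a + b) + ta`.
      · have := mul_nonneg (sub_nonneg.2 (hpow n)) (sq_nonneg (a + b))
        have := mul_nonneg (pow_nonneg (by norm_num : (0 : ℝ) ≤ 1 / 2) n) h
        nlinarith
  · have h' : 0 ≤ b * (a + b) := by nlinarith [sq_nonneg (a + b)]
    have hc : Continuous fun t : ℝ => listNorm E (l₁ ++ t :: (a + b - t) :: l₂) := by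
      simp only [listNorm, listVec_append, listVec]
      fun_prop
    have hlim := (hc.tendsto 0).comp (h0 a)
    have hz : listNorm E (l₁ ++ 0 :: (a + b - 0) :: l₂) = listNorm E (l₁ ++ (a + b) :: l₂) := by
      simpa using hE.listNorm_insert_zero l₁ ((a + b) :: l₂)
    rw [hz] at hlim
    refine le_of_tendsto' hlim fun n => ?_
    induction n with
    | zero => simp
    | succ n ih =>
      refine le_trans (le_of_eq ?_) ((hE.listNorm_halve_right l₁ l₂ (a * (1 / 2) ^ n)
        (a + b - a * (1 / 2) ^ n) ?_).trans ih)
      · simp only [Function.comp]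
        ring_nf
      · have := mul_nonneg (sub_nonneg.2 (hpow n)) (sq_nonneg (a + b))
        have := mul_nonneg (pow_nonneg (by norm_num : (0 : ℝ) ≤ 1 / 2) n) h'
        nlinarith

/-- Merging a block of adjacent coefficients does not increase the norm. -/
theorem listNorm_sum_le (l₁ l l₂ : List ℝ) :
    listNorm E (l₁ ++ l.sum :: l₂) ≤ listNorm E (l₁ ++ (l ++ l₂)) := by
  induction l generalizing l₁ with
  | nil => simpa using (hE.listNorm_insert_zero l₁ l₂).le
  | cons a l ih =>
    rw [List.sum_cons]
    refine (hE.listNorm_merge_le _ _ _ _).trans ?_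
    simpa using ih (l₁ ++ [a])

/-- Merging a block of adjacent nonnegative coefficients preserves the norm. -/
theorem listNorm_sum_eq (l₁ l l₂ : List ℝ) (h : ∀ a ∈ l, 0 ≤ a) :
    listNorm E (l₁ ++ l.sum :: l₂) = listNorm E (l₁ ++ (l ++ l₂)) := by
  induction l generalizing l₁ with
  | nil => simpa using hE.listNorm_insert_zero l₁ l₂
  | cons a l ih =>
    have hl : ∀ b ∈ l, 0 ≤ b := fun b hb => h b (List.mem_cons_of_mem _ hb)
    rw [List.sum_cons, ← hE.listNorm_merge _ _ _ _
      (mul_nonneg (h a List.mem_cons_self) (List.sum_nonneg hl))]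
    simpa using ih (l₁ ++ [a]) hl

theorem listNorm_remove_le (l₁ l l₂ : List ℝ) (h : l.sum = 0) :
    listNorm E (l₁ ++ l₂) ≤ listNorm E (l₁ ++ (l ++ l₂)) := by
  have := hE.listNorm_sum_le l₁ l l₂
  rwa [h, hE.listNorm_insert_zero] at this

/-- Shift invariance: starting at `k` amounts to prepending `k` zeros. -/
theorem norm_listVec_eq (k : ℕ) (l : List ℝ) : ‖listVec E k l‖ = listNorm E l := by
  have h₁ : ∀ j (m : List ℝ), listNorm E (List.replicate j 0 ++ m) = listNorm E m := by
    intro j m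
    induction j with
    | zero => simp
    | succ j ih =>
      rw [List.replicate_succ, List.cons_append]
      exact (hE.listNorm_insert_zero [] _).trans ih
  have h₂ : ∀ j i, listVec E i (List.replicate j 0) = 0 := by
    intro j
    induction j with
    | zero => simp [listVec]
    | succ j ih => simp [List.replicate_succ, listVec, ih]
  rw [← h₁ k l, listNorm, listVec_append, h₂]
  simp

theorem listNorm_append_le (l₁ l₂ : List ℝ) :
    listNorm E (l₁ ++ l₂) ≤ listNorm E l₁ + listNorm E l₂ := by
  rw [listNorm, listVec_append, ← hE.norm_listVec_eq (0 + l₁.length) l₂]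
  exact norm_add_le _ _

end IsESA

/-! ### Alternating vectors -/

/-- The norm of `(1, -1, 1, -1, …, 1, -1)` with `n` pairs. -/
def altNorm (E : ℕ → X) (n : ℕ) : ℝ :=
  listNorm E ((List.range n).flatMap fun _ => [1, -1])

theorem listNorm_flatMap_const {Ω : Type*} (q : ℝ) (ws : List Ω) :
    listNorm E (ws.flatMap fun _ => [q, -q]) = |q| * altNorm E ws.length := by
  have h : ∀ k (ws : List Ω), listVec E k (ws.flatMap fun _ => [q, -q]) =
      q • listVec E k ((List.range ws.length).flatMap fun _ => [1, -1]) := by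
    intro k ws
    rw [← listVec_map_mul]
    congr 1
    induction ws with
    | nil => simp
    | cons a l ih =>
      simp [List.range_succ_eq_map, List.flatMap_map, ih]
  rw [listNorm, h, norm_smul, Real.norm_eq_abs]
  rfl

theorem altNorm_zero : altNorm E 0 = 0 := by
  simp [altNorm, listNorm, listVec]

theorem flatMap_range_add (m n : ℕ) :
    ((List.range (m + n)).flatMap fun _ => [(1 : ℝ), -1]) =
      ((List.range m).flatMap fun _ => [1, -1]) ++ (List.range n).flatMap fun _ => [1, -1] := by
  rw [List.range_add, List.flatMap_append, List.flatMap_map]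

namespace IsESA

variable (hE : IsESA E)
include hE

theorem altNorm_add_le (m n : ℕ) : altNorm E (m + n) ≤ altNorm E m + altNorm E n := by
  rw [altNorm, flatMap_range_add]
  exact hE.listNorm_append_le _ _

theorem altNorm_mono : Monotone (altNorm E) := by
  refine monotone_nat_of_le_succ fun n => ?_
  have := hE.listNorm_remove_le ((List.range n).flatMap fun _ => [1, -1]) [1, -1] [] (by simp)
  rw [altNorm, altNorm, flatMap_range_add]
  simpa using this

theorem altNorm_mul_le (c n : ℕ) : altNorm E (c * n) ≤ c * altNorm E n := by
  induction c with
  | zero => simp [altNorm_zero]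
  | succ c ih =>
    rw [Nat.succ_mul]
    refine (hE.altNorm_add_le _ _).trans ?_
    push_cast
    linarith

theorem altNorm_pos (hlin : LinearIndependent ℝ E) {n : ℕ} (hn : 0 < n) : 0 < altNorm E n := by
  refine lt_of_lt_of_le ?_ (hE.altNorm_mono hn)
  have h : altNorm E 1 = ‖E 0 - E 1‖ := by
    simp [altNorm, listNorm, listVec, sub_eq_add_neg]
  rw [Nat.succ_eq_add_one, zero_add, h, norm_pos_iff, sub_ne_zero]
  exact fun h => absurd (hlin.injective h) (by norm_num)

/-! ### Concatenations of blocks -/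

theorem listNorm_flatMap_eq {Ω : Type*} (ws : List Ω) (g : Ω → List ℝ) (q : ℝ)
    (hg : ∀ ω ∈ ws, (∀ a ∈ g ω, 0 ≤ a) ∧ (g ω).sum = q) :
    listNorm E (ws.flatMap fun ω => g ω ++ [-q]) = |q| * altNorm E ws.length := by
  rw [← listNorm_flatMap_const]
  suffices H : ∀ l₁, listNorm E (l₁ ++ ws.flatMap fun ω => g ω ++ [-q]) =
      listNorm E (l₁ ++ ws.flatMap fun _ => [q, -q]) from H []
  induction ws with
  | nil => simp
  | cons w ws ih =>
    intro l₁
    obtain ⟨h₁, h₂⟩ := hg w List.mem_cons_self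
    have h₃ := hE.listNorm_sum_eq l₁ (g w) (-q :: ws.flatMap fun ω => g ω ++ [-q]) h₁
    have h₄ := ih (fun ω hω => hg ω (List.mem_cons_of_mem _ hω)) (l₁ ++ [q, -q])
    rw [h₂] at h₃
    simp only [List.flatMap_cons, List.append_assoc, List.cons_append, List.nil_append] at *
    rw [← h₃, h₄]

/-- A good block is cut after `l` and its two parts are merged; as the whole sums to zero, they
become `q` and `-q`. Any other block merges to zero and disappears. -/
theorem le_listNorm_flatMap {Ω : Type*} (ws : List Ω) (G : Ω → Prop) [DecidablePred G]
    (g : Ω → List ℝ) (q : ℝ) (hsum : ∀ ω, (g ω).sum = 0)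
    (hg : ∀ ω, G ω → ∃ l l', g ω = l ++ l' ∧ l.sum = q) :
    |q| * altNorm E (ws.filter fun ω => decide (G ω)).length ≤ listNorm E (ws.flatMap g) := by
  rw [← listNorm_flatMap_const]
  suffices H : ∀ l₁, listNorm E (l₁ ++ (ws.filter fun ω => decide (G ω)).flatMap
      fun _ => [q, -q]) ≤ listNorm E (l₁ ++ ws.flatMap g) from H []
  induction ws with
  | nil => simp
  | cons w ws ih =>
    intro l₁
    by_cases hw : G w
    · obtain ⟨l, l', hl, hq⟩ := hg w hw
      have hq' : l'.sum = -q := by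
        have := hsum w
        rw [hl, List.sum_append, hq] at this
        linarith
      have h₁ := hE.listNorm_sum_le l₁ l (l' ++ ws.flatMap g)
      have h₂ := hE.listNorm_sum_le (l₁ ++ [q]) l' (ws.flatMap g)
      have h₃ := ih (l₁ ++ [q, -q])
      rw [hq] at h₁
      rw [hq'] at h₂
      simp only [hw, hl, decide_true, List.filter_cons_of_pos, List.flatMap_cons,
        List.append_assoc, List.cons_append, List.nil_append] at *
      exact h₃.trans (h₂.trans h₁)
    · simp only [hw, decide_false, List.flatMap_cons, Bool.false_eq_true, not_false_eq_true,
        List.filter_cons_of_neg]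
      exact (ih l₁).trans (hE.listNorm_remove_le l₁ (g w) _ (hsum w))

end IsESA
end ListVec
/-! ### Initial segments of finite sets of naturals -/

/-- The first `j` elements of `D` in increasing (`b = true`) or decreasing (`b = false`) order. -/
def initSeg (b : Bool) (j : ℕ) (D : Finset ℕ) : Finset ℕ :=
  if b then ((D.sort (· ≤ ·)).take j).toFinset else ((D.sort (· ≥ ·)).take j).toFinset

theorem initSeg_subset (b : Bool) (j : ℕ) (D : Finset ℕ) : initSeg b j D ⊆ D := by
  intro a ha
  cases b <;> simp only [initSeg, if_true, Bool.false_eq_true, if_false, List.mem_toFinset] at ha <;>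
    simpa using List.mem_of_mem_take ha

theorem card_initSeg (b : Bool) (j : ℕ) (D : Finset ℕ) (hj : j ≤ D.card) :
    (initSeg b j D).card = j := by
  cases b
  · simp only [initSeg, Bool.false_eq_true, if_false]
    rw [List.toFinset_card_of_nodup ((Finset.sort_nodup _ _).sublist (List.take_sublist _ _))]
    simpa using hj
  · simp only [initSeg, if_true]
    rw [List.toFinset_card_of_nodup ((Finset.sort_nodup _ _).sublist (List.take_sublist _ _))]
    simpa using hj

theorem initSeg_mono (b : Bool) {i j : ℕ} (hij : i ≤ j) (D : Finset ℕ) :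
    initSeg b i D ⊆ initSeg b j D := by
  intro a ha
  cases b <;> simp only [initSeg, if_true, Bool.false_eq_true, if_false, List.mem_toFinset] at * <;>
    exact (List.take_prefix_take_left hij).subset ha

/-- `Before b a c` means that `a` comes before `c` in the order encoded by `b`. -/
def Before (b : Bool) (a c : ℕ) : Prop := if b then a < c else c < a

theorem before_of_mem_initSeg (b : Bool) {j : ℕ} {D : Finset ℕ} {a c : ℕ}
    (ha : a ∈ initSeg b j D) (hc : c ∈ D) (hc' : c ∉ initSeg b j D) : Before b a c := by
  have key : ∀ (l : List ℕ) (R : ℕ → ℕ → Prop), l.Pairwise R → a ∈ l.take j → c ∈ l →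
      c ∉ l.take j → R a c := by
    intro l R hl ha hc hc'
    rw [← List.take_append_drop j l] at hl hc
    rcases List.mem_append.1 hc with h | h
    · exact absurd h hc'
    · exact (List.pairwise_append.1 hl).2.2 a ha c h
  cases b
  · simp only [initSeg, Bool.false_eq_true, if_false, List.mem_toFinset, Before] at *
    exact key _ _ (Finset.sortedGT_sort D).pairwise ha (by simpa using hc) hc'
  · simp only [initSeg, if_true, List.mem_toFinset, Before] at *
    exact key _ _ (Finset.sortedLT_sort D).pairwise ha (by simpa using hc) hc'

/-! ### The functions `x` and `y` -/

section XY

variable {M : ℕ} {W : Fin (M + 2) → ℕ}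

theorem x_le (r : Fin (M + 2)) (i : ℕ) : x W r i ≤ r := by
  rw [x]
  split_ifs
  · exact Fin.zero_le _
  · exact Finset.sup_le fun t ht => (Finset.mem_filter.1 ht).2.2

theorem le_y (r : Fin (M + 2)) (i : ℕ) : r ≤ y W r i := by
  rw [y]
  split_ifs
  · exact Fin.le_last _
  · exact Finset.le_inf fun t ht => (Finset.mem_filter.1 ht).2.2

theorem le_x {r t : Fin (M + 2)} {i : ℕ} (ht : W t < i) (htr : t ≤ r) : t ≤ x W r i := by
  rw [x, if_neg (by omega)]
  exact Finset.le_sup (f := id) (by simp [ht, htr])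

theorem y_le {r t : Fin (M + 2)} {i : ℕ} (ht : W t < i) (htr : r ≤ t) : y W r i ≤ t := by
  rw [y, if_neg (by omega)]
  exact Finset.inf_le (f := id) (by simp [ht, htr])

theorem W_x_lt (h0 : W 0 = 0) (r : Fin (M + 2)) {i : ℕ} (hi : 0 < i) : W (x W r i) < i := by
  rw [x, if_neg (by omega)]
  obtain ⟨t, ht, h⟩ := Finset.exists_mem_eq_sup (Finset.univ.filter fun t => W t < i ∧ t ≤ r)
    ⟨0, by simp [h0, hi]⟩ id
  rw [h]
  exact (Finset.mem_filter.1 ht).2.1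

theorem W_y_lt (h1 : W (Fin.last (M + 1)) = 0) (r : Fin (M + 2)) {i : ℕ} (hi : 0 < i) :
    W (y W r i) < i := by
  rw [y, if_neg (by omega)]
  obtain ⟨t, ht, h⟩ := Finset.exists_mem_eq_inf (Finset.univ.filter fun t => W t < i ∧ r ≤ t)
    ⟨Fin.last (M + 1), by simp [h1, hi, Fin.le_last]⟩ id
  rw [h]
  exact (Finset.mem_filter.1 ht).2.1

theorem x_eq_self {r : Fin (M + 2)} {i : ℕ} (h : W r < i) : x W r i = r :=
  le_antisymm (x_le r i) (le_x h le_rfl)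

theorem y_eq_self {r : Fin (M + 2)} {i : ℕ} (h : W r < i) : y W r i = r :=
  le_antisymm (y_le h le_rfl) (le_y r i)

theorem x_mono {r s : Fin (M + 2)} (i : ℕ) (h : r ≤ s) : x W r i ≤ x W s i := by
  rw [x, x]
  split_ifs
  · exact le_rfl
  · exact Finset.sup_mono fun t ht => by
      simp only [Finset.mem_filter, Finset.mem_univ, true_and] at ht ⊢
      exact ⟨ht.1, ht.2.trans h⟩

theorem y_mono {r s : Fin (M + 2)} (i : ℕ) (h : r ≤ s) : y W r i ≤ y W s i := by
  rw [y, y]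
  split_ifs
  · exact le_rfl
  · exact Finset.inf_mono fun t ht => by
      simp only [Finset.mem_filter, Finset.mem_univ, true_and] at ht ⊢
      exact ⟨ht.1, h.trans ht.2⟩

/-- If no height of depth `< i` lies between `r` and `s`, they have the same lower neighbour. -/
theorem x_congr (h0 : W 0 = 0) {r s : Fin (M + 2)} {i : ℕ} (hi : 0 < i) (hrs : r ≤ s)
    (h : ∀ t, r ≤ t → t ≤ s → i ≤ W t) : x W r i = x W s i := by
  refine le_antisymm (x_mono i hrs) (le_x (W_x_lt h0 s hi) ?_)
  by_contra hlt
  exact absurd (h _ (not_le.1 hlt).le (x_le s i)) (not_le.2 (W_x_lt h0 s hi))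

theorem y_congr (h1 : W (Fin.last (M + 1)) = 0) {r s : Fin (M + 2)} {i : ℕ} (hi : 0 < i)
    (hrs : r ≤ s) (h : ∀ t, r ≤ t → t ≤ s → i ≤ W t) : y W r i = y W s i := by
  refine le_antisymm (y_mono i hrs) (y_le (W_y_lt h1 r hi) ?_)
  by_contra hlt
  exact absurd (h _ (le_y r i) (not_le.1 hlt).le) (not_le.2 (W_y_lt h1 r hi))

/-! ### The sets attached to heights -/

/-- The set of size `t` attached to the height `t` after the arrangements of the first `k` levels,
where `ε j` tells whether the gaps are filled in increasing or decreasing order at level `j`. -/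
noncomputable def level (W : Fin (M + 2) → ℕ) (ε : ℕ → Bool) : ℕ → Fin (M + 2) → Finset ℕ
  -- Only heights of depth 0 keep this value; all others are overwritten at level 1.
  | 0, t => Finset.range t
  | k + 1, t => level W ε k (x W t (k + 1)) ∪
      initSeg (ε (k + 1)) (t - x W t (k + 1))
        (level W ε k (y W t (k + 1)) \ level W ε k (x W t (k + 1)))

theorem level_congr {ε ε' : ℕ → Bool} {k : ℕ} (h : ∀ j, 0 < j → j ≤ k → ε j = ε' j) :
    level W ε k = level W ε' k := by
  induction k with
  | zero => rfl
  | succ k ih =>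
    funext t
    rw [level, level, ih fun j h₁ h₂ => h j h₁ (by omega), h (k + 1) (by omega) le_rfl]

variable (h0 : W 0 = 0) (h1 : W (Fin.last (M + 1)) = 0) (ε : ℕ → Bool)

/-- Such a height is its own lower and upper neighbour, so its gap is empty and its set is final. -/
theorem level_succ_of_lt {k : ℕ} {t : Fin (M + 2)} (ht : W t < k + 1) :
    level W ε (k + 1) t = level W ε k t := by
  rw [level, x_eq_self ht, y_eq_self ht, Finset.sdiff_self]
  exact Finset.union_eq_left.2 ((initSeg_subset _ _ _).trans (Finset.empty_subset _))

theorem level_of_le {k k' : ℕ} {t : Fin (M + 2)} (ht : W t ≤ k) (hk : k ≤ k') :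
    level W ε k' t = level W ε k t := by
  induction k', hk using Nat.le_induction with
  | base => rfl
  | succ n hn ih => rw [level_succ_of_lt ε (by omega), ih]

-- The two claims need each other: the size of a gap comes from both at the previous level. For
-- monotonicity, a height of depth at most `k` between `s` and `t` has a set separating theirs;
-- without one, `s` and `t` share a gap and take initial segments of it in the same order.
include h0 h1 in
theorem level_mono_and_card (k : ℕ) :
    Monotone (level W ε k) ∧ ∀ t, (level W ε k t).card = t := by
  induction k with
  | zero =>
    refine ⟨fun s t h => ?_, fun t => Finset.card_range _⟩
    exact Finset.range_subset_range.2 h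
  | succ k ih =>
    obtain ⟨hm, hc⟩ := ih
    have hD : ∀ t, (level W ε k (y W t (k + 1)) \ level W ε k (x W t (k + 1))).card =
        (y W t (k + 1) : ℕ) - x W t (k + 1) := fun t => by
      rw [Finset.card_sdiff_of_subset (hm ((x_le t _).trans (le_y t _))), hc, hc]
    have hy : ∀ t, level W ε (k + 1) t ⊆ level W ε k (y W t (k + 1)) := fun t =>
      Finset.union_subset (hm ((x_le t _).trans (le_y t _)))
        ((initSeg_subset _ _ _).trans Finset.sdiff_subset)
    have hx : ∀ t, level W ε k (x W t (k + 1)) ⊆ level W ε (k + 1) t := fun t =>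
      Finset.subset_union_left
    constructor
    · intro s t hst
      by_cases hg : ∀ i, s ≤ i → i ≤ t → k + 1 ≤ W i
      · rw [level, level, x_congr h0 (by omega) hst hg, y_congr h1 (by omega) hst hg]
        exact Finset.union_subset_union le_rfl
          (initSeg_mono _ (Nat.sub_le_sub_right hst _) _)
      · push Not at hg
        obtain ⟨i, hi₁, hi₂, hi₃⟩ := hg
        exact (hy s).trans ((hm ((y_le hi₃ hi₁).trans (le_x hi₃ hi₂))).trans (hx t))
    · intro t
      have h₁ : (x W t (k + 1) : ℕ) ≤ t := x_le t _
      have h₂ : (t : ℕ) ≤ y W t (k + 1) := le_y t _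
      rw [level, Finset.card_union_of_disjoint, hc, card_initSeg _ _ _ (by rw [hD]; omega)]
      · omega
      · exact (Finset.disjoint_sdiff).mono_right (initSeg_subset _ _ _)

include h0 h1 in
theorem level_mono (k : ℕ) : Monotone (level W ε k) := (level_mono_and_card h0 h1 ε k).1

include h0 h1 in
theorem card_level (k : ℕ) (t : Fin (M + 2)) : (level W ε k t).card = t :=
  (level_mono_and_card h0 h1 ε k).2 t

include h0 h1 in
theorem level_subset_range (k : ℕ) (t : Fin (M + 2)) :
    level W ε k t ⊆ Finset.range (M + 1) := by
  refine (level_mono h0 h1 ε k (Fin.le_last t)).trans ?_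
  rw [level_of_le ε h1.le (Nat.zero_le k)]
  simp [level]

/-- `I` consists of the first elements of `D` in the order encoded by `b`. -/
def IsInit (b : Bool) (I D : Finset ℕ) : Prop :=
  ∀ a ∈ I, ∀ c ∈ D, c ∉ I → Before b a c

theorem IsInit.subset_of_card_le {b : Bool} {I J D : Finset ℕ} (hI : IsInit b I D)
    (hJ : IsInit b J D) (hID : I ⊆ D) (hJD : J ⊆ D) (h : I.card ≤ J.card) : I ⊆ J := by
  intro a ha
  by_contra haJ
  have : ¬ J ⊆ I := fun hJI => haJ (Finset.eq_of_subset_of_card_le hJI h ▸ ha)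
  obtain ⟨c, hcJ, hcI⟩ := Finset.not_subset.1 this
  have h₁ := hI a ha c (hJD hcJ) hcI
  have h₂ := hJ c hcJ a (hID ha) haJ
  cases b <;> simp only [Before, if_true, Bool.false_eq_true, if_false] at h₁ h₂ <;> omega

-- Refining a gap repeatedly in one and the same direction agrees with filling it in that direction
-- at once: each new set extends an initial segment by the first elements of what lies between it
-- and a larger initial segment.
variable {ε} in
include h0 h1 in
theorem isInit_level {m k : ℕ} (hk : m ≤ k) {b : Bool} (hε : ∀ j, m < j → j ≤ k → ε j = b)
    (r : Fin (M + 2)) {t : Fin (M + 2)} (hxt : x W r (m + 1) ≤ t) (hty : t ≤ y W r (m + 1))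
    (ht : W t ≤ k) :
    IsInit b (level W ε k t \ level W ε m (x W r (m + 1)))
      (level W ε m (y W r (m + 1)) \ level W ε m (x W r (m + 1))) := by
  have hWx : W (x W r (m + 1)) ≤ m := Nat.lt_succ_iff.1 (W_x_lt h0 r (Nat.succ_pos m))
  have hWy : W (y W r (m + 1)) ≤ m := Nat.lt_succ_iff.1 (W_y_lt h1 r (Nat.succ_pos m))
  induction k, hk using Nat.le_induction generalizing t with
  | base =>
    intro a ha c hc hc'
    rcases le_total t r with h | h
    · rw [le_antisymm (le_x (Nat.lt_succ_iff.2 ht) h) hxt, Finset.sdiff_self] at ha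
      simp at ha
    · rw [le_antisymm hty (y_le (Nat.lt_succ_iff.2 ht) h)] at hc'
      exact absurd hc hc'
  | succ k hk ih =>
    have ih' := fun t => @ih (fun j h₁ h₂ => hε j h₁ (by omega)) t
    set X := level W ε m (x W r (m + 1))
    have ihx := ih' (x W t (k + 1)) (le_x (by omega) hxt) ((x_le t _).trans hty)
      (Nat.lt_succ_iff.1 (W_x_lt h0 t (Nat.succ_pos k)))
    have ihy := ih' (y W t (k + 1)) (hxt.trans (le_y t _)) (y_le (by omega) hty)
      (Nat.lt_succ_iff.1 (W_y_lt h1 t (Nat.succ_pos k)))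
    have hX : X ⊆ level W ε k (x W t (k + 1)) := by
      have := level_mono h0 h1 ε k (le_x (W := W) (i := k + 1) (by omega) hxt)
      rwa [level_of_le ε hWx hk] at this
    intro a ha c hc hc'
    rw [level, hε (k + 1) (by omega) le_rfl] at ha hc'
    simp only [Finset.mem_sdiff, Finset.mem_union, not_and, not_not] at ha hc hc' ihx ihy
    have hcX := hc.2
    have hc₁ : c ∉ level W ε k (x W t (k + 1)) := fun h => hcX (hc' (Or.inl h))
    have hc₂ : c ∉ initSeg b (t - x W t (k + 1))
        (level W ε k (y W t (k + 1)) \ level W ε k (x W t (k + 1))) :=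
      fun h => hcX (hc' (Or.inr h))
    rcases ha.1 with h | h
    · exact ihx a (by simp [h, ha.2]) c (by simpa using hc) (by simp [hc₁])
    · by_cases hcy : c ∈ level W ε k (y W t (k + 1))
      · exact before_of_mem_initSeg b h (by simp [hcy, hc₁]) hc₂
      · have := Finset.mem_sdiff.1 (initSeg_subset _ _ _ h)
        exact ihy a (by simp [this.1, ha.2]) c (by simpa using hc) (by simp [hcy])

/-! ### Halves of a gap filled in one direction -/

section Split

variable {ε}
variable {p m K : ℕ} (hp : Admissible W p) (hK : m + p ≤ K) {b : Bool}
  (hε : ∀ j, m < j → j ≤ m + p → ε j = b) {r : Fin (M + 2)} {H : Finset ℕ}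
  (hHD : H ⊆ level W ε m (y W r (m + 1)) \ level W ε m (x W r (m + 1)))
  (hH : IsInit b H (level W ε m (y W r (m + 1)) \ level W ε m (x W r (m + 1))))
include h0 h1 hp hK hε hHD hH

/-- Admissibility provides a height `t ≤ r` of depth at most `m + p` at or above the midpoint of the
gap. Its set fills an initial segment of the gap at least as large as `H`, and lies in the set of
`r`. -/
theorem subset_level_of_half_le
    (hr : (x W r (m + 1) : ℕ) + y W r (m + 1) ≤ 2 * r)
    (hcard : 2 * H.card ≤ (y W r (m + 1) : ℕ) - x W r (m + 1) + 1) : H ⊆ level W ε K r := by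
  have hadm : (x W r (m + 1) : ℕ) + y W r (m + 1) ≤ 2 * (x W r (m + 1 + p) : ℕ) := by
    have h := (hp r (m + 1)).1 (by
      have : ((x W r (m + 1) : ℕ) + (y W r (m + 1) : ℕ) : ℝ) ≤ 2 * ((r : ℕ) : ℝ) := by
        exact_mod_cast hr
      linarith)
    have : ((x W r (m + 1) : ℕ) + (y W r (m + 1) : ℕ) : ℝ) ≤
      2 * ((x W r (m + 1 + p) : ℕ) : ℝ) := by linarith
    exact_mod_cast this
  set t := x W r (m + 1 + p) with ht
  have htr : t ≤ r := x_le _ _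
  have hWx : W (x W r (m + 1)) < m + 1 := W_x_lt h0 r (Nat.succ_pos m)
  have hxt : x W r (m + 1) ≤ t := le_x (by omega) (x_le _ _)
  have hty : t ≤ y W r (m + 1) := htr.trans (le_y _ _)
  have hWt : W t ≤ m + p := by
    have := W_x_lt h0 r (i := m + 1 + p) (by omega)
    rw [← ht] at this
    omega
  have hinit := isInit_level h0 h1 (Nat.le_add_right m p) hε r hxt hty hWt
  have hX : level W ε m (x W r (m + 1)) ⊆ level W ε (m + p) t := by
    rw [← level_of_le ε (Nat.lt_succ_iff.1 hWx) (Nat.le_add_right m p)]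
    exact level_mono h0 h1 ε _ hxt
  have hY : level W ε (m + p) t ⊆ level W ε m (y W r (m + 1)) := by
    rw [← level_of_le ε (Nat.lt_succ_iff.1 (W_y_lt h1 r (Nat.succ_pos m)))
      (Nat.le_add_right m p)]
    exact level_mono h0 h1 ε _ hty
  have hxy : (x W r (m + 1) : ℕ) ≤ y W r (m + 1) := (x_le r _).trans (le_y r _)
  have hsub := hH.subset_of_card_le hinit hHD (Finset.sdiff_subset_sdiff hY le_rfl) (by
    rw [Finset.card_sdiff_of_subset hX, card_level h0 h1, card_level h0 h1]
    omega)
  refine hsub.trans (Finset.sdiff_subset.trans ?_)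
  rw [← level_of_le ε hWt hK]
  exact level_mono h0 h1 ε K htr

/-- Mirror image: here `t ≥ r` is at or below the midpoint, and its set bounds that of `r` from
above. -/
theorem level_subset_of_le_half
    (hr : 2 * (r : ℕ) ≤ x W r (m + 1) + y W r (m + 1))
    (hcard : (y W r (m + 1) : ℕ) - x W r (m + 1) ≤ 2 * H.card + 1) :
    level W ε K r \ level W ε m (x W r (m + 1)) ⊆ H := by
  have hadm : 2 * (y W r (m + 1 + p) : ℕ) ≤ (x W r (m + 1) : ℕ) + y W r (m + 1) := by
    have h := (hp r (m + 1)).2 (by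
      have : 2 * ((r : ℕ) : ℝ) ≤ ((x W r (m + 1) : ℕ) + (y W r (m + 1) : ℕ) : ℝ) := by
        exact_mod_cast hr
      linarith)
    have : 2 * ((y W r (m + 1 + p) : ℕ) : ℝ) ≤
      ((x W r (m + 1) : ℕ) + (y W r (m + 1) : ℕ) : ℝ) := by linarith
    exact_mod_cast this
  set t := y W r (m + 1 + p) with ht
  have htr : r ≤ t := le_y _ _
  have hWy : W (y W r (m + 1)) < m + 1 := W_y_lt h1 r (Nat.succ_pos m)
  have hxt : x W r (m + 1) ≤ t := (x_le _ _).trans htr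
  have hty : t ≤ y W r (m + 1) := y_le (by omega) (le_y _ _)
  have hWt : W t ≤ m + p := by
    have := W_y_lt h1 r (i := m + 1 + p) (by omega)
    rw [← ht] at this
    omega
  have hinit := isInit_level h0 h1 (Nat.le_add_right m p) hε r hxt hty hWt
  have hX : level W ε m (x W r (m + 1)) ⊆ level W ε (m + p) t := by
    rw [← level_of_le ε (Nat.lt_succ_iff.1 (W_x_lt h0 r (Nat.succ_pos m)))
      (Nat.le_add_right m p)]
    exact level_mono h0 h1 ε _ hxt
  have hY : level W ε (m + p) t ⊆ level W ε m (y W r (m + 1)) := by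
    rw [← level_of_le ε (Nat.lt_succ_iff.1 hWy) (Nat.le_add_right m p)]
    exact level_mono h0 h1 ε _ hty
  have hsub := hinit.subset_of_card_le hH (Finset.sdiff_subset_sdiff hY le_rfl) hHD (by
    rw [Finset.card_sdiff_of_subset hX, card_level h0 h1, card_level h0 h1]
    omega)
  refine (Finset.sdiff_subset_sdiff ?_ le_rfl).trans hsub
  rw [← level_of_le ε hWt hK]
  exact level_mono h0 h1 ε K htr

end Split

theorem card_filter_lt_eq {X Y Z H : Finset ℕ} {θ : ℕ} (hXZ : X ⊆ Z) (hZY : Z ⊆ Y)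
    (hθ : ∀ a ∈ Y \ X, a < θ ↔ a ∈ H) :
    (Z.filter (· < θ)).card = (X.filter (· < θ)).card + ((Z \ X) ∩ H).card := by
  rw [← Finset.card_union_of_disjoint]
  · congr 1
    ext a
    simp only [Finset.mem_filter, Finset.mem_union, Finset.mem_inter, Finset.mem_sdiff]
    constructor
    · rintro ⟨ha, hlt⟩
      by_cases haX : a ∈ X
      · exact Or.inl ⟨haX, hlt⟩
      · exact Or.inr ⟨⟨ha, haX⟩, (hθ a (Finset.mem_sdiff.2 ⟨hZY ha, haX⟩)).1 hlt⟩
    · rintro (⟨ha, hlt⟩ | ⟨⟨ha, haX⟩, haH⟩)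
      · exact ⟨hXZ ha, hlt⟩
      · exact ⟨ha, (hθ a (Finset.mem_sdiff.2 ⟨hZY ha, haX⟩)).2 haH⟩
  · rw [Finset.disjoint_left]
    intro a ha ha'
    simp only [Finset.mem_filter, Finset.mem_inter, Finset.mem_sdiff] at ha ha'
    exact ha'.1.2 ha.1

include h0 h1 in
/-- If the levels `m + 1, …, m + p` are filled in increasing order for `r` and in decreasing order
for `s`, some initial segment contains many more elements of the first set than of the second. -/
theorem exists_card_filter_lt_eq {p m K : ℕ} (hp : Admissible W p) (hK : m + p ≤ K)
    {ε ε' : ℕ → Bool} (hagree : ∀ j, 0 < j → j ≤ m → ε j = ε' j)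
    (hε : ∀ j, m < j → j ≤ m + p → ε j = true) (hε' : ∀ j, m < j → j ≤ m + p → ε' j = false)
    {r s : Fin (M + 2)} (hx : x W r (m + 1) = x W s (m + 1))
    (hy : y W r (m + 1) = y W s (m + 1)) {q : ℕ}
    (hq : ((x W r (m + 1) : ℕ) + y W r (m + 1) ≤ 2 * r ∧
        (x W r (m + 1) : ℕ) + y W r (m + 1) ≤ 2 * s ∧ q = y W r (m + 1) - s) ∨
      (2 * (r : ℕ) ≤ (x W r (m + 1) : ℕ) + y W r (m + 1) ∧
        2 * (s : ℕ) ≤ (x W r (m + 1) : ℕ) + y W r (m + 1) ∧ q = r - x W r (m + 1)) ∨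
      ((x W r (m + 1) : ℕ) + y W r (m + 1) ≤ 2 * r ∧
        2 * (s : ℕ) ≤ (x W r (m + 1) : ℕ) + y W r (m + 1) ∧
        q = (y W r (m + 1) - x W r (m + 1) + 1) / 2)) :
    ∃ θ ≤ M + 1, ((level W ε K r).filter (· < θ)).card =
      ((level W ε' K s).filter (· < θ)).card + q := by
  have hlev : level W ε m = level W ε' m := level_congr hagree
  have hxr : (x W r (m + 1) : ℕ) ≤ r := x_le r _
  have hry : (r : ℕ) ≤ y W r (m + 1) := le_y r _
  have hxs : (x W r (m + 1) : ℕ) ≤ s := by rw [hx]; exact x_le s _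
  have hsy : (s : ℕ) ≤ y W r (m + 1) := by rw [hy]; exact le_y s _
  have hWx : W (x W r (m + 1)) ≤ m := Nat.lt_succ_iff.1 (W_x_lt h0 r (Nat.succ_pos m))
  have hWy : W (y W r (m + 1)) ≤ m := Nat.lt_succ_iff.1 (W_y_lt h1 r (Nat.succ_pos m))
  set X := level W ε m (x W r (m + 1)) with hXdef
  set Y := level W ε m (y W r (m + 1)) with hYdef
  set D := Y \ X with hD
  set U := level W ε K r
  set V := level W ε' K s
  have hXc : X.card = x W r (m + 1) := card_level h0 h1 _ _ _
  have hYc : Y.card = y W r (m + 1) := card_level h0 h1 _ _ _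
  have hXY : X ⊆ Y := level_mono h0 h1 ε m ((x_le r _).trans (le_y r _))
  have hDc : D.card = (y W r (m + 1) : ℕ) - x W r (m + 1) := by
    rw [hD, Finset.card_sdiff_of_subset hXY, hXc, hYc]
  have hXU : X ⊆ U := by
    rw [hXdef, ← level_of_le ε hWx (show m ≤ K by omega)]
    exact level_mono h0 h1 ε K (x_le r _)
  have hUY : U ⊆ Y := by
    rw [hYdef, ← level_of_le ε hWy (show m ≤ K by omega)]
    exact level_mono h0 h1 ε K (le_y r _)
  have hXV : X ⊆ V := by
    rw [hXdef, hlev, ← level_of_le ε' hWx (show m ≤ K by omega)]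
    exact level_mono h0 h1 ε' K hxs
  have hVY : V ⊆ Y := by
    rw [hYdef, hlev, ← level_of_le ε' hWy (show m ≤ K by omega)]
    exact level_mono h0 h1 ε' K hsy
  have hUc : (U \ X).card = (r : ℕ) - x W r (m + 1) := by
    rw [Finset.card_sdiff_of_subset hXU, hXc, card_level h0 h1]
  have hVc : (V \ X).card = (s : ℕ) - x W r (m + 1) := by
    rw [Finset.card_sdiff_of_subset hXV, hXc, card_level h0 h1]
  -- `H` is the lower half of the gap, rounded up. Its complement is initial for the decreasing
  -- order, so one cut serves both filling directions.
  set H := initSeg true ((D.card + 1) / 2) D with hHdef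
  have hHc : H.card = (D.card + 1) / 2 := card_initSeg _ _ _ (by omega)
  have hHD : H ⊆ D := initSeg_subset _ _ _
  have hH : IsInit true H D := fun a ha c hc hc' => before_of_mem_initSeg true ha hc hc'
  have hH' : IsInit false (D \ H) D := by
    intro a ha c hc hc'
    rw [Finset.mem_sdiff] at ha
    have hcH : c ∈ H := by
      by_contra h
      exact hc' (Finset.mem_sdiff.2 ⟨hc, h⟩)
    have := hH c hcH a ha.1 ha.2
    simpa [Before] using this
  have hHc' : (D \ H).card = D.card - H.card := Finset.card_sdiff_of_subset hHD
  have hUge : (x W r (m + 1) : ℕ) + y W r (m + 1) ≤ 2 * r → H ⊆ U := fun h =>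
    subset_level_of_half_le h0 h1 hp hK hε hHD hH h (by omega)
  have hUle : 2 * (r : ℕ) ≤ (x W r (m + 1) : ℕ) + y W r (m + 1) → U \ X ⊆ H := fun h =>
    level_subset_of_le_half h0 h1 hp hK hε hHD hH h (by omega)
  have hVge : (x W r (m + 1) : ℕ) + y W r (m + 1) ≤ 2 * s → D \ H ⊆ V := fun h => by
    refine subset_level_of_half_le h0 h1 hp hK hε' (r := s) ?_ ?_ (by rwa [← hx, ← hy])
      (by rw [← hx, ← hy]; omega)
    · rw [← hx, ← hy, ← hlev]; exact Finset.sdiff_subset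
    · rw [← hx, ← hy, ← hlev]; exact hH'
  have hVle : 2 * (s : ℕ) ≤ (x W r (m + 1) : ℕ) + y W r (m + 1) → V \ X ⊆ D \ H := fun h => by
    have := level_subset_of_le_half h0 h1 hp hK hε' (r := s) (H := D \ H) ?_ ?_
      (by rwa [← hx, ← hy]) (by rw [← hx, ← hy]; omega)
    · rwa [← hx, ← hlev] at this
    · rw [← hx, ← hy, ← hlev]; exact Finset.sdiff_subset
    · rw [← hx, ← hy, ← hlev]; exact hH'
  have hθ : ∃ θ ≤ M + 1, ∀ a ∈ D, a < θ ↔ a ∈ H := by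
    -- The threshold is one more than the largest element of `H`, and `0` if `H` is empty.
    refine ⟨H.sup Nat.succ, Finset.sup_le fun a ha => ?_, fun a ha => ⟨fun h => ?_, fun h => ?_⟩⟩
    · exact Finset.mem_range.1
        (level_subset_range h0 h1 ε m _ (Finset.sdiff_subset (hHD ha)))
    · obtain ⟨c, hc, hac⟩ := (Finset.lt_sup_iff).1 h
      by_contra haH
      have : c < a := by simpa [Before] using hH c hc a ha haH
      omega
    · exact Nat.lt_of_succ_le (Finset.le_sup (f := Nat.succ) h)
  obtain ⟨θ, hθM, hθ⟩ := hθ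
  have hcount : ∀ Z : Finset ℕ, X ⊆ Z → Z ⊆ Y →
      (Z.filter (· < θ)).card = (X.filter (· < θ)).card + ((Z \ X) ∩ H).card :=
    fun Z hXZ hZY => card_filter_lt_eq hXZ hZY hθ
  refine ⟨θ, hθM, ?_⟩
  rw [hcount U hXU hUY, hcount V hXV hVY, add_assoc]
  congr 1
  have hHX : Disjoint H X := (Finset.sdiff_disjoint (s := X) (t := Y)).mono_left hHD
  have hUH : H ⊆ U → ((U \ X) ∩ H).card = H.card := fun h => by
    rw [Finset.inter_eq_right.2 (Finset.subset_sdiff.2 ⟨h, hHX⟩)]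
  have hVH : V \ X ⊆ D \ H → ((V \ X) ∩ H).card = 0 := fun h => by
    rw [Finset.card_eq_zero, ← Finset.disjoint_iff_inter_eq_empty]
    exact Finset.sdiff_disjoint.mono_left h
  rcases hq with ⟨hr, hs, hq⟩ | ⟨hr, hs, hq⟩ | ⟨hr, hs, hq⟩
  -- In the upper half, `V` contains all of `D \ H`, so it misses only points of `H`, namely `b - s`
  -- of them with `b` the top of the gap, while `U` contains all of `H`.
  · have h₁ : ((V \ X) ∩ H).card + (D \ H).card = (V \ X).card := by
      rw [← Finset.card_inter_add_card_sdiff (V \ X) H]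
      congr 2
      refine le_antisymm (fun a ha => ?_)
        (Finset.sdiff_subset_sdiff (Finset.sdiff_subset_sdiff hVY le_rfl) le_rfl)
      have := hVge hs ha
      simp only [hD, Finset.mem_sdiff] at ha ⊢
      exact ⟨⟨this, ha.1.2⟩, ha.2⟩
    have := Finset.card_le_card hHD
    rw [hUH (hUge hr)]
    omega
  · rw [hVH (hVle hs), Finset.inter_eq_left.2 (hUle hr)]
    omega
  · rw [hUH (hUge hr), hVH (hVle hs)]
    omega

end XY
/-! ### Common initial segments -/

section Meet

variable {α : Type*} [DecidableEq α]

theorem length_meet_comm (A B : List α) : (meet A B).length = (meet B A).length :=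
  le_antisymm (prefix_meet _ _ _ (meet_prefix_right A B) (meet_prefix_left A B)).length_le
    (prefix_meet _ _ _ (meet_prefix_right B A) (meet_prefix_left B A)).length_le

theorem take_eq_take_of_le_length_meet {A B : List α} {j : ℕ} (hj : j ≤ (meet A B).length) :
    A.take j = B.take j := by
  have h₁ := List.prefix_iff_eq_take.1 (meet_prefix_left A B)
  have h₂ := List.prefix_iff_eq_take.1 (meet_prefix_right A B)
  have h₃ := congrArg (List.take j) (h₁.symm.trans h₂)
  simpa [List.take_take, hj] using h₃

theorem take_ne_take_of_length_meet_lt {A B : List α} {j k : ℕ} (hA : (meet A B).length < A.length)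
    (hj : (meet A B).length < j) : A.take j ≠ B.take k := by
  intro h
  have := (prefix_meet (A.take j) A B (List.take_prefix _ _)
    (h ▸ List.take_prefix _ _)).length_le
  rw [List.length_take] at this
  omega

end Meet

/-! ### Distances in bundle graphs -/

section Graph

variable {M : ℕ} {W : Fin (M + 2) → ℕ} {κ : ℕ}

theorem UpDown.symm {u v : Vertex W κ} (h : UpDown u v) : UpDown v u := by
  obtain ⟨t, h₁, h₂, h₃⟩ := h
  exact ⟨t, by rwa [min_comm], by rwa [max_comm], by rwa [length_meet_comm]⟩

theorem UpDown.of_adj {u v : Vertex W κ} (h : (graph W κ).Adj u v) : UpDown u v := by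
  rcases h.2 with h | h
  · exact ⟨u.height, min_le_left _ _, le_max_left _ _, by
      rw [← u.length_label]
      exact (prefix_meet _ _ _ List.prefix_rfl h).length_le⟩
  · exact ⟨v.height, min_le_right _ _, le_max_right _ _, by
      rw [← v.length_label]
      exact (prefix_meet _ _ _ h List.prefix_rfl).length_le⟩

/-- The vertex at height `t` on the branch given by an infinite sequence. -/
def branch (W : Fin (M + 2) → ℕ) (f : ℕ → Fin κ) (t : Fin (M + 2)) : Vertex W κ :=
  ⟨t, (List.range (W t)).map f, by simp⟩

theorem map_range_prefix {α : Type*} (f : ℕ → α) {m n : ℕ} (h : m ≤ n) :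
    (List.range m).map f <+: (List.range n).map f := by
  obtain ⟨k, rfl⟩ := Nat.exists_eq_add_of_le h
  rw [List.range_add, List.map_append]
  exact List.prefix_append _ _

theorem exists_walk_branch (f : ℕ → Fin κ) (n : ℕ) (s t : Fin (M + 2)) (h : (s : ℕ) + n = t) :
    ∃ w : (graph W κ).Walk (branch W f s) (branch W f t), w.length = n := by
  induction n generalizing s with
  | zero =>
    obtain rfl : s = t := Fin.ext h
    exact ⟨.nil, rfl⟩
  | succ n ih =>
    obtain ⟨w, hw⟩ := ih ⟨s + 1, by omega⟩ (by simp; omega)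
    have hadj : (graph W κ).Adj (branch W f s) (branch W f ⟨s + 1, by omega⟩) :=
      ⟨Or.inl rfl, (le_total _ _).imp (map_range_prefix f) (map_range_prefix f)⟩
    exact ⟨.cons hadj w, by rw [SimpleGraph.Walk.length_cons, hw]⟩

/-- An infinite continuation of the label of a vertex. -/
def extend (c : Fin κ) (u : Vertex W κ) (i : ℕ) : Fin κ := u.label.getD i c

theorem branch_extend_of_le (c : Fin κ) (u : Vertex W κ) {t : Fin (M + 2)}
    (h : W t ≤ W u.height) : branch W (extend c u) t = ⟨t, u.label.take (W t), by
      simp [u.length_label, h]⟩ := by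
  refine Vertex.ext rfl ?_
  refine List.ext_getElem (by simp [branch, u.length_label, h]) fun i h₁ h₂ => ?_
  have : i < u.label.length := by simp at h₂; omega
  simp [branch, extend, this]

theorem branch_extend_height (c : Fin κ) (u : Vertex W κ) :
    branch W (extend c u) u.height = u := by
  rw [branch_extend_of_le c u le_rfl]
  exact Vertex.ext rfl (by simp [← u.length_label])

/-- The two branches meet at height `t`, since its label is cut from the common part. All walks
below are routed through such a meeting point. -/
theorem branch_extend_eq (c : Fin κ) (u v : Vertex W κ) {t : Fin (M + 2)}
    (h : W t ≤ (meet u.label v.label).length) :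
    branch W (extend c u) t = branch W (extend c v) t := by
  rw [branch_extend_of_le, branch_extend_of_le]
  · exact Vertex.ext rfl (take_eq_take_of_le_length_meet h)
  · exact h.trans (v.length_label ▸ (meet_prefix_right _ _).length_le)
  · exact h.trans (u.length_label ▸ (meet_prefix_left _ _).length_le)

theorem exists_walk_above [NeZero κ] (u v : Vertex W κ) {t : Fin (M + 2)}
    (h : W t ≤ (meet u.label v.label).length) (hu : u.height ≤ t) (hv : v.height ≤ t) :
    ∃ w : (graph W κ).Walk u v, w.length = ((t : ℕ) - u.height) + (t - v.height) := by
  have hu' : (u.height : ℕ) ≤ t := hu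
  have hv' : (v.height : ℕ) ≤ t := hv
  obtain ⟨w₁, hw₁⟩ := exists_walk_branch (W := W) (extend 0 u) (t - u.height) u.height t (by omega)
  have H := exists_walk_branch (W := W) (extend 0 v) (t - v.height) v.height t (by omega)
  rw [← branch_extend_eq 0 u v h] at H
  obtain ⟨w₂, hw₂⟩ := H
  refine ⟨(w₁.append w₂.reverse).copy (branch_extend_height 0 u) (branch_extend_height 0 v), ?_⟩
  simp [hw₁, hw₂]

theorem exists_walk_below [NeZero κ] (u v : Vertex W κ) {t : Fin (M + 2)}
    (h : W t ≤ (meet u.label v.label).length) (hu : t ≤ u.height) (hv : t ≤ v.height) :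
    ∃ w : (graph W κ).Walk u v, w.length = ((u.height : ℕ) - t) + (v.height - t) := by
  have hu' : (t : ℕ) ≤ u.height := hu
  have hv' : (t : ℕ) ≤ v.height := hv
  obtain ⟨w₁, hw₁⟩ := exists_walk_branch (W := W) (extend 0 u) (u.height - t) t u.height (by omega)
  have H := exists_walk_branch (W := W) (extend 0 v) (v.height - t) t v.height (by omega)
  rw [← branch_extend_eq 0 u v h] at H
  obtain ⟨w₂, hw₂⟩ := H
  refine ⟨(w₁.reverse.append w₂).copy (branch_extend_height 0 u) (branch_extend_height 0 v), ?_⟩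
  simp [hw₁, hw₂]

theorem exists_walk_between [NeZero κ] (u v : Vertex W κ) {t : Fin (M + 2)}
    (h : W t ≤ (meet u.label v.label).length) (hu : u.height ≤ t) (hv : t ≤ v.height) :
    ∃ w : (graph W κ).Walk u v, w.length = (v.height : ℕ) - u.height := by
  have hu' : (u.height : ℕ) ≤ t := hu
  have hv' : (t : ℕ) ≤ v.height := hv
  obtain ⟨w₁, hw₁⟩ := exists_walk_branch (W := W) (extend 0 u) (t - u.height) u.height t (by omega)
  have H := exists_walk_branch (W := W) (extend 0 v) (v.height - t) t v.height (by omega)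
  rw [← branch_extend_eq 0 u v h] at H
  obtain ⟨w₂, hw₂⟩ := H
  refine ⟨(w₁.append w₂).copy (branch_extend_height 0 u) (branch_extend_height 0 v), ?_⟩
  simp [hw₁, hw₂]
  omega

theorem dist_le_of_upDown [NeZero κ] {u v : Vertex W κ} (h : UpDown u v)
    (huv : u.height ≤ v.height) :
    (graph W κ).dist u v ≤ (v.height : ℕ) - u.height := by
  obtain ⟨t, h₁, h₂, h₃⟩ := h
  rw [min_eq_left huv] at h₁
  rw [max_eq_right huv] at h₂
  obtain ⟨w, hw⟩ := exists_walk_between u v h₃ h₁ h₂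
  exact hw ▸ SimpleGraph.dist_le w

theorem graph_reachable [NeZero κ] (h0 : W 0 = 0) (u v : Vertex W κ) :
    (graph W κ).Reachable u v :=
  let ⟨w, _⟩ := exists_walk_below u v (t := 0) (by simp [h0]) (Fin.zero_le _) (Fin.zero_le _)
  ⟨w⟩

theorem norm_sub_le_dist {X : Type*} [SeminormedAddCommGroup X] {V : Type*} {G : SimpleGraph V}
    (ψ : V → X) (hψ : ∀ u v, G.Adj u v → ‖ψ u - ψ v‖ ≤ 1) {u v : V} (h : G.Reachable u v) :
    ‖ψ u - ψ v‖ ≤ (G.dist u v : ℝ) := by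
  obtain ⟨w, hw⟩ := h.exists_walk_length_eq_dist
  rw [← hw]
  clear hw h
  induction w with
  | nil => simp
  | @cons a b c hab w ih =>
    have := norm_sub_le_norm_sub_add_norm_sub (ψ a) (ψ b) (ψ c)
    have := hψ _ _ hab
    push_cast [SimpleGraph.Walk.length_cons]
    linarith

end Graph

/-! ### Random arrangements -/

section Arrangement

variable {M : ℕ} {W : Fin (M + 2) → ℕ} {κ : ℕ}

/-- The finite sequences that occur in the labels. -/
abbrev Word (W : Fin (M + 2) → ℕ) (κ : ℕ) : Type :=
  {l : List (Fin κ) // l.length ≤ maxDepth W}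

noncomputable instance : Fintype (Word W κ) :=
  @Fintype.ofFinite _ (List.finite_length_le (Fin κ) (maxDepth W)).to_subtype

theorem le_maxDepth (t : Fin (M + 2)) : W t ≤ maxDepth W :=
  Finset.le_sup (f := W) (Finset.mem_univ t)

/-- The initial segments of the label of a vertex. -/
def prefixWord (u : Vertex W κ) (j : ℕ) : Word W κ :=
  ⟨u.label.take j, by
    have := le_maxDepth (W := W) u.height
    rw [← u.length_label] at this
    exact (List.length_take_le' _ _).trans this⟩

theorem prefixWord_eq {u v : Vertex W κ} {j : ℕ} (hj : j ≤ (meet u.label v.label).length) :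
    prefixWord u j = prefixWord v j :=
  Subtype.ext (take_eq_take_of_le_length_meet hj)

/-- The set of size `u.height` attached to the vertex `u` by the bits `ω`. -/
noncomputable def vertexSet (ω : Word W κ → Bool) (u : Vertex W κ) : Finset ℕ :=
  level W (fun j => ω (prefixWord u j)) (W u.height) u.height

theorem vertexSet_eq_level (ω : Word W κ → Bool) (u : Vertex W κ) {K : ℕ}
    (hK : W u.height ≤ K) :
    vertexSet ω u = level W (fun j => ω (prefixWord u j)) K u.height :=
  (level_of_le _ le_rfl hK).symm

variable (h0 : W 0 = 0) (h1 : W (Fin.last (M + 1)) = 0)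
include h0 h1

/-- At the height `t` witnessing `u ⇕ v`, only bits at common prefixes matter, so both branches
attach the same set to `t`; it lies between the two sets. -/
theorem vertexSet_subset (ω : Word W κ → Bool) {u v : Vertex W κ} (h : UpDown u v)
    (huv : u.height ≤ v.height) : vertexSet ω u ⊆ vertexSet ω v := by
  obtain ⟨t, h₁, h₂, h₃⟩ := h
  rw [min_eq_left huv] at h₁
  rw [max_eq_right huv] at h₂
  rw [vertexSet_eq_level ω u (le_maxDepth _), vertexSet_eq_level ω v (le_maxDepth _)]
  refine (level_mono h0 h1 _ _ h₁).trans (le_trans (le_of_eq ?_) (level_mono h0 h1 _ _ h₂))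
  rw [level_of_le _ le_rfl (le_maxDepth t), level_of_le _ le_rfl (le_maxDepth t)]
  exact congrFun (level_congr fun j _ hj => by rw [prefixWord_eq (hj.trans h₃)]) t

omit h0 h1 in
theorem depth_of_not_upDown {u v : Vertex W κ} (h : ¬ UpDown u v) {t : Fin (M + 2)}
    (h₁ : min u.height v.height ≤ t) (h₂ : t ≤ max u.height v.height) :
    (meet u.label v.label).length + 1 ≤ W t := by
  by_contra hlt
  exact h ⟨t, h₁, h₂, by omega⟩

omit h1 in
theorem x_eq_of_not_upDown {u v : Vertex W κ} (h : ¬ UpDown u v) :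
    x W u.height ((meet u.label v.label).length + 1) =
      x W v.height ((meet u.label v.label).length + 1) := by
  rcases le_total u.height v.height with huv | huv
  · refine x_congr h0 (Nat.succ_pos _) huv fun t h₁ h₂ => depth_of_not_upDown h ?_ ?_
    · rwa [min_eq_left huv]
    · rwa [max_eq_right huv]
  · refine (x_congr h0 (Nat.succ_pos _) huv fun t h₁ h₂ => depth_of_not_upDown h ?_ ?_).symm
    · rwa [min_eq_right huv]
    · rwa [max_eq_left huv]

omit h0 in
theorem y_eq_of_not_upDown {u v : Vertex W κ} (h : ¬ UpDown u v) :
    y W u.height ((meet u.label v.label).length + 1) =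
      y W v.height ((meet u.label v.label).length + 1) := by
  rcases le_total u.height v.height with huv | huv
  · refine y_congr h1 (Nat.succ_pos _) huv fun t h₁ h₂ => depth_of_not_upDown h ?_ ?_
    · rwa [min_eq_left huv]
    · rwa [max_eq_right huv]
  · refine (y_congr h1 (Nat.succ_pos _) huv fun t h₁ h₂ => depth_of_not_upDown h ?_ ?_).symm
    · rwa [min_eq_right huv]
    · rwa [max_eq_left huv]

end Arrangement

/-! ### The proportion of favourable bit choices -/

/-- Overwriting the prescribed bits makes any `ω` favourable, and `ω` is recovered from its `2p` old
values. Repetitions within `a` or within `b` do no harm. -/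
theorem card_bool_fun_le {σ : Type*} [Fintype σ] [DecidableEq σ] {p : ℕ} (a b : Fin p → σ)
    (hab : ∀ i j, a i ≠ b j) :
    Fintype.card (σ → Bool) ≤ 2 ^ (2 * p) *
      (Finset.univ.filter fun ω : σ → Bool => ∀ i, ω (a i) = true ∧ ω (b i) = false).card := by
  let F : (σ → Bool) → ((Fin p → Bool) × (Fin p → Bool)) × (σ → Bool) := fun ω =>
    ((ω ∘ a, ω ∘ b), fun s => if ∃ i, a i = s then true else if ∃ i, b i = s then false else ω s)
  have hF : Function.Injective F := by
    intro ω ω' h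
    simp only [F, Prod.mk.injEq] at h
    funext s
    by_cases hsa : ∃ i, a i = s
    · obtain ⟨i, rfl⟩ := hsa
      exact congrFun h.1.1 i
    by_cases hsb : ∃ i, b i = s
    · obtain ⟨i, rfl⟩ := hsb
      exact congrFun h.1.2 i
    simpa [hsa, hsb] using congrFun h.2 s
  have := Finset.card_le_card_of_injOn (s := Finset.univ)
    (t := (Finset.univ : Finset ((Fin p → Bool) × (Fin p → Bool))) ×ˢ
      Finset.univ.filter fun ω : σ → Bool => ∀ i, ω (a i) = true ∧ ω (b i) = false) F
    (fun ω _ => by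
      have h : ∀ i, ¬ ∃ j, a j = b i := fun i ⟨j, hj⟩ => hab j i hj
      simp [F, h]) hF.injOn
  refine this.trans (le_of_eq ?_)
  rw [Finset.card_product]
  simp [two_mul, pow_add]

/-! ### The embedding -/

section Embedding

variable {X : Type*} [NormedAddCommGroup X] [NormedSpace ℝ X] {E : ℕ → X}
variable {M : ℕ} {W : Fin (M + 2) → ℕ} {κ : ℕ}

/-- The coefficients of the block of `u` that belongs to the bits `ω`: the indicator function of
`vertexSet ω u` on `{0, …, M}`, followed by minus the height of `u`. -/
noncomputable def blockCoeff (u : Vertex W κ) (i : (Word W κ → Bool) × ℕ) : ℝ :=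
  if i.2 < M + 1 then (if i.2 ∈ vertexSet i.1 u then 1 else 0) else -(u.height : ℕ)

/-- The positions of the entries of all blocks. -/
noncomputable def blockIndices (W : Fin (M + 2) → ℕ) (κ : ℕ) :
    List ((Word W κ → Bool) × ℕ) :=
  (Finset.univ : Finset (Word W κ → Bool)).toList.flatMap fun ω =>
    (List.range (M + 2)).map fun i => (ω, i)

/-- The embedding of the bundle graph. -/
noncomputable def embedding (E : ℕ → X) (u : Vertex W κ) : X :=
  (altNorm E (Fintype.card (Word W κ → Bool)))⁻¹ •
    listVec E 0 ((blockIndices W κ).map (blockCoeff u))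

/-- The entries of the difference of the blocks of `u` and `v`, without the last one. -/
noncomputable def diffBlock (u v : Vertex W κ) (ω : Word W κ → Bool) : List ℝ :=
  (List.range (M + 1)).map fun i =>
    (if i ∈ vertexSet ω u then 1 else 0) - (if i ∈ vertexSet ω v then 1 else 0)

theorem norm_embedding_sub (u v : Vertex W κ) :
    ‖embedding E u - embedding E v‖ = (altNorm E (Fintype.card (Word W κ → Bool)))⁻¹ *
      listNorm E ((Finset.univ : Finset (Word W κ → Bool)).toList.flatMap fun ω =>
        diffBlock u v ω ++ [-((u.height : ℕ) - (v.height : ℕ) : ℝ)]) := by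
  rw [embedding, embedding, ← smul_sub, listVec_map_sub, norm_smul, Real.norm_eq_abs,
    abs_of_nonneg (inv_nonneg.2 (show 0 ≤ altNorm E _ from norm_nonneg _)), listNorm]
  congr 3
  rw [blockIndices, List.map_flatMap]
  congr 1
  funext ω
  rw [List.range_succ, List.map_append, List.map_append, diffBlock]
  congr 1
  · rw [List.map_map]
    refine List.map_congr_left fun i hi => ?_
    have hi' : i < M + 1 := List.mem_range.1 hi
    simp only [Function.comp, blockCoeff, hi', if_true]
  · simp [blockCoeff]
    ring

theorem sum_map_range_indicator (S T : Finset ℕ) (θ : ℕ) :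
    ((List.range θ).map fun i => (if i ∈ S then (1 : ℝ) else 0) - (if i ∈ T then 1 else 0)).sum =
      ((S.filter (· < θ)).card : ℝ) - (T.filter (· < θ)).card := by
  have h : ∀ S : Finset ℕ, ∑ i ∈ Finset.range θ, (if i ∈ S then (1 : ℝ) else 0) =
      (S.filter (· < θ)).card := fun S => by
    rw [Finset.sum_boole]
    congr 2
    ext i
    simp [and_comm]
  rw [← h, ← h, ← Finset.sum_sub_distrib]
  rfl

variable (h0 : W 0 = 0) (h1 : W (Fin.last (M + 1)) = 0)
include h0 h1

theorem card_vertexSet (ω : Word W κ → Bool) (u : Vertex W κ) :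
    (vertexSet ω u).card = u.height := card_level h0 h1 _ _ _

theorem sum_diffBlock (u v : Vertex W κ) (ω : Word W κ → Bool) :
    (diffBlock u v ω).sum = (u.height : ℕ) - (v.height : ℕ) := by
  have h : ∀ u : Vertex W κ, (vertexSet ω u).filter (· < M + 1) = vertexSet ω u := fun u =>
    Finset.filter_true_of_mem fun i hi =>
      Finset.mem_range.1 (level_subset_range h0 h1 _ _ _ hi)
  rw [diffBlock, sum_map_range_indicator, h, h, card_vertexSet h0 h1, card_vertexSet h0 h1]

variable (hE : IsESA E) (hlin : LinearIndependent ℝ E)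
include hE hlin

theorem norm_embedding_sub_of_upDown {u v : Vertex W κ} (h : UpDown u v)
    (huv : u.height ≤ v.height) :
    ‖embedding E u - embedding E v‖ = (v.height : ℕ) - (u.height : ℕ) := by
  rw [norm_sub_rev, norm_embedding_sub, hE.listNorm_flatMap_eq _ _ _ fun ω _ =>
    ⟨fun a ha => ?_, sum_diffBlock h0 h1 v u ω⟩, Finset.length_toList, Finset.card_univ,
    abs_of_nonneg]
  · have := hE.altNorm_pos hlin (Fintype.card_pos (α := Word W κ → Bool))
    field_simp
  · rw [sub_nonneg]
    exact_mod_cast huv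
  · obtain ⟨i, _, rfl⟩ := List.mem_map.1 ha
    have hi : i ∈ vertexSet ω u → i ∈ vertexSet ω v := fun hi => vertexSet_subset h0 h1 ω h huv hi
    split_ifs <;> simp_all

theorem le_norm_embedding_sub {p : ℕ} (hp : Admissible W p) {u v : Vertex W κ}
    (h : ¬ UpDown u v) {a b q : ℕ}
    (ha : a = x W u.height ((meet u.label v.label).length + 1))
    (hb : b = y W u.height ((meet u.label v.label).length + 1))
    (hq : (a + b ≤ 2 * u.height ∧ a + b ≤ 2 * v.height ∧ q = b - v.height) ∨
      (2 * (u.height : ℕ) ≤ a + b ∧ 2 * (v.height : ℕ) ≤ a + b ∧ q = u.height - a) ∨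
      (a + b ≤ 2 * u.height ∧ 2 * (v.height : ℕ) ≤ a + b ∧ q = (b - a + 1) / 2)) :
    (q : ℝ) / 2 ^ (2 * p) ≤ ‖embedding E u - embedding E v‖ := by
  classical
  set m := (meet u.label v.label).length
  have hmu : m < u.label.length := by
    rw [u.length_label]
    exact depth_of_not_upDown h (min_le_left _ _) (le_max_left _ _)
  -- Past the end of the label these words are all the whole label; such repetitions are allowed in
  -- the count.
  let A : Fin p → Word W κ := fun i => prefixWord u (m + 1 + i)
  let B : Fin p → Word W κ := fun i => prefixWord v (m + 1 + i)
  have hAB : ∀ i j, A i ≠ B j := fun i j hij =>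
    take_ne_take_of_length_meet_lt hmu (by omega) (congrArg Subtype.val hij)
  have hcard := card_bool_fun_le A B hAB
  set G : (Word W κ → Bool) → Prop := fun ω => ∀ i, ω (A i) = true ∧ ω (B i) = false
  set n := Fintype.card (Word W κ → Bool)
  have hlow := hE.le_listNorm_flatMap (Finset.univ : Finset (Word W κ → Bool)).toList G
    (fun ω => diffBlock u v ω ++ [-((u.height : ℕ) - (v.height : ℕ) : ℝ)]) q
    (fun ω => by simp [sum_diffBlock h0 h1]) (fun ω hω => by
      obtain ⟨θ, hθM, hθ⟩ := exists_card_filter_lt_eq h0 h1 hp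
        -- The common level must reach `m + p` and also be late enough for both vertex sets to be
        -- final.
        (le_max_right (maxDepth W) (m + p))
        (ε := fun j => ω (prefixWord u j)) (ε' := fun j => ω (prefixWord v j))
        (fun j _ hj => by rw [prefixWord_eq hj])
        (fun j h₁ h₂ => by
          have := (hω ⟨j - (m + 1), by omega⟩).1
          simpa only [A, show m + 1 + (j - (m + 1)) = j by omega] using this)
        (fun j h₁ h₂ => by
          have := (hω ⟨j - (m + 1), by omega⟩).2
          simpa only [B, show m + 1 + (j - (m + 1)) = j by omega] using this)
        (x_eq_of_not_upDown h0 h) (y_eq_of_not_upDown h1 h) (by rwa [← ha, ← hb])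
      rw [← vertexSet_eq_level ω u (le_max_of_le_left (le_maxDepth _)),
        ← vertexSet_eq_level ω v (le_max_of_le_left (le_maxDepth _))] at hθ
      refine ⟨(diffBlock u v ω).take θ, (diffBlock u v ω).drop θ ++
        [-((u.height : ℕ) - (v.height : ℕ) : ℝ)], ?_, ?_⟩
      · rw [← List.append_assoc, List.take_append_drop]
      · rw [diffBlock, ← List.map_take, List.take_range, min_eq_left hθM,
          sum_map_range_indicator, hθ]
        push_cast
        ring)
  have hlen : ((Finset.univ : Finset (Word W κ → Bool)).toList.filter
      fun ω => decide (G ω)).length = (Finset.univ.filter G).card := by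
    rw [← Multiset.coe_card, ← Multiset.filter_coe, Finset.coe_toList]
    rfl
  rw [hlen, abs_of_nonneg (Nat.cast_nonneg q)] at hlow
  have hn : 0 < altNorm E n := hE.altNorm_pos hlin Fintype.card_pos
  have hmul := (hE.altNorm_mono hcard).trans (hE.altNorm_mul_le _ _)
  push_cast at hmul
  rw [norm_embedding_sub, div_le_iff₀ (by positivity), mul_assoc, inv_mul_eq_div, le_div_iff₀ hn]
  calc (q : ℝ) * altNorm E n
      ≤ q * (2 ^ (2 * p) * altNorm E (Finset.univ.filter G).card) := by gcongr
    _ = (q * altNorm E (Finset.univ.filter G).card) * 2 ^ (2 * p) := by ring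
    _ ≤ _ := by gcongr

theorem dist_le_two_pow_mul_norm [NeZero κ] {p : ℕ} (hp : Admissible W p) {u v : Vertex W κ}
    (h : ¬ UpDown u v) :
    1 / 2 ^ (2 * p + 1) * ((graph W κ).dist u v : ℝ) ≤ ‖embedding E u - embedding E v‖ := by
  suffices H : ∃ q : ℕ, (graph W κ).dist u v ≤ 2 * q ∧
      (q : ℝ) / 2 ^ (2 * p) ≤ ‖embedding E u - embedding E v‖ by
    obtain ⟨q, hq, hle⟩ := H
    refine le_trans ?_ hle
    have : ((graph W κ).dist u v : ℝ) ≤ 2 * q := by exact_mod_cast hq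
    rw [pow_succ, div_mul_eq_mul_div, one_mul, div_le_div_iff₀ (by positivity) (by positivity)]
    have h2 : (0 : ℝ) < 2 ^ (2 * p) := by positivity
    nlinarith
  have h' : ¬ UpDown v u := fun h' => h h'.symm
  have hx := x_eq_of_not_upDown h0 h
  have hy := y_eq_of_not_upDown h1 h
  have L₁ := fun q hq => le_norm_embedding_sub h0 h1 hE hlin hp h (q := q) rfl rfl hq
  have L₂ := fun q hq => le_norm_embedding_sub h0 h1 hE hlin hp h' (q := q)
    (a := x W u.height ((meet u.label v.label).length + 1))
    (b := y W u.height ((meet u.label v.label).length + 1))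
    (by rw [length_meet_comm v.label, hx]) (by rw [length_meet_comm v.label, hy]) hq
  rw [norm_sub_rev] at L₂
  set m := (meet u.label v.label).length
  obtain ⟨w₁, hw₁⟩ := exists_walk_below u v (t := x W u.height (m + 1))
    (Nat.lt_succ_iff.1 (W_x_lt h0 _ (Nat.succ_pos m))) (x_le _ _) (hx ▸ x_le _ _)
  obtain ⟨w₂, hw₂⟩ := exists_walk_above u v (t := y W u.height (m + 1))
    (Nat.lt_succ_iff.1 (W_y_lt h1 _ (Nat.succ_pos m))) (le_y _ _) (hy ▸ le_y _ _)
  have hd₁ := hw₁ ▸ SimpleGraph.dist_le w₁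
  have hd₂ := hw₂ ▸ SimpleGraph.dist_le w₂
  have hxu : (x W u.height (m + 1) : ℕ) ≤ u.height := x_le _ _
  have hxv : (x W u.height (m + 1) : ℕ) ≤ v.height := hx ▸ x_le _ _
  have hyu : (u.height : ℕ) ≤ y W u.height (m + 1) := le_y _ _
  have hyv : (v.height : ℕ) ≤ y W u.height (m + 1) := hy ▸ le_y _ _
  set a : ℕ := (x W u.height (m + 1)).val
  set b : ℕ := (y W u.height (m + 1)).val
  rcases le_total (a + b) (2 * u.height) with hu | hu <;>
    rcases le_total (a + b) (2 * v.height) with hv | hv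
  · rcases le_total (u.height : ℕ) v.height with huv | huv
    -- The walk through `b` has length `(b - u) + (b - v)`, at most twice the larger term; the order
    -- of `u` and `v` is chosen so that `q` is that term.
    · exact ⟨b - u.height, by omega, L₂ _ (Or.inl ⟨hv, hu, rfl⟩)⟩
    · exact ⟨b - v.height, by omega, L₁ _ (Or.inl ⟨hu, hv, rfl⟩)⟩
  -- The walks through `a` and through `b` have total length `2(b - a)`, so the shorter one has
  -- length at most `b - a ≤ 2q`.
  · exact ⟨(b - a + 1) / 2, by omega, L₁ _ (Or.inr (Or.inr ⟨hu, hv, rfl⟩))⟩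
  · exact ⟨(b - a + 1) / 2, by omega, L₂ _ (Or.inr (Or.inr ⟨hv, hu, rfl⟩))⟩
  · rcases le_total (u.height : ℕ) v.height with huv | huv
    · exact ⟨v.height - a, by omega, L₂ _ (Or.inr (Or.inl ⟨hv, hu, rfl⟩))⟩
    · exact ⟨u.height - a, by omega, L₁ _ (Or.inr (Or.inl ⟨hu, hv, rfl⟩))⟩

end Embedding

/-! ### The bound on the parameter and the proof of the theorem -/

theorem admissible_maxDepth {M : ℕ} (W : Fin (M + 2) → ℕ) : Admissible W (maxDepth W + 1) := by
  intro r i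
  have hr : W r < i + (maxDepth W + 1) := by
    have := le_maxDepth (W := W) r
    omega
  rw [x_eq_self hr, y_eq_self hr]
  exact ⟨id, id⟩

end BundleGraph

theorem mainTheorem4 {X : Type*} [NormedAddCommGroup X] [NormedSpace ℝ X] [CompleteSpace X]
    (e : SchauderBasis ℝ X) (he : BundleGraph.IsESA (fun n => e n))
    {M : ℕ} (W : Fin (M + 2) → ℕ) (hW_bot : W 0 = 0) (hW_top : W (Fin.last (M + 1)) = 0)
    (κ : ℕ) (hκ : 1 ≤ κ) :
    BundleGraph.pParam W ≤ BundleGraph.maxDepth W + 1 ∧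
    ∃ ψ : BundleGraph.Vertex W κ → X,
      (∀ u v : BundleGraph.Vertex W κ,
        1 / 2 ^ (2 * BundleGraph.pParam W + 1) * ((BundleGraph.graph W κ).dist u v : ℝ)
            ≤ ‖ψ u - ψ v‖ ∧
          ‖ψ u - ψ v‖ ≤ ((BundleGraph.graph W κ).dist u v : ℝ)) ∧
      (∀ u v : BundleGraph.Vertex W κ, BundleGraph.UpDown u v →
        ‖ψ u - ψ v‖ = ((BundleGraph.graph W κ).dist u v : ℝ)) := by
  open BundleGraph in
  have : NeZero κ := ⟨by omega⟩
  have hlin : LinearIndependent ℝ (fun n => e n) := e.linearIndependent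
  have hp : Admissible W (pParam W) := (Nat.sInf_mem (admissible_nonempty W)).2
  have hdiff : ∀ u v : Vertex W κ, UpDown u v → u.height ≤ v.height →
      ‖embedding (fun n => e n) u - embedding (fun n => e n) v‖ =
        (v.height : ℕ) - (u.height : ℕ) := fun u v h huv =>
    norm_embedding_sub_of_upDown hW_bot hW_top he hlin h huv
  have hadj : ∀ u v : Vertex W κ, (graph W κ).Adj u v →
      ‖embedding (fun n => e n) u - embedding (fun n => e n) v‖ ≤ 1 := by
    intro u v h
    rcases h.1 with h' | h'
    · rw [hdiff u v (.of_adj h) (Fin.le_def.2 (by omega)), ← h']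
      simp
    · rw [norm_sub_rev, hdiff v u (.of_adj h.symm) (Fin.le_def.2 (by omega)), ← h']
      simp
  have hlip : ∀ u v : Vertex W κ,
      ‖embedding (fun n => e n) u - embedding (fun n => e n) v‖ ≤ ((graph W κ).dist u v : ℝ) :=
    fun u v => norm_sub_le_dist _ hadj (graph_reachable hW_bot u v)
  have heq' : ∀ u v : Vertex W κ, UpDown u v → u.height ≤ v.height →
      ‖embedding (fun n => e n) u - embedding (fun n => e n) v‖ = ((graph W κ).dist u v : ℝ) := by
    intro u v h huv
    refine le_antisymm (hlip u v) ?_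
    rw [hdiff u v h huv, ← Nat.cast_sub huv]
    exact_mod_cast dist_le_of_upDown h huv
  have heq : ∀ u v : Vertex W κ, UpDown u v →
      ‖embedding (fun n => e n) u - embedding (fun n => e n) v‖ = ((graph W κ).dist u v : ℝ) := by
    intro u v h
    rcases le_total u.height v.height with huv | huv
    · exact heq' u v h huv
    · rw [norm_sub_rev, SimpleGraph.dist_comm]
      exact heq' v u h.symm huv
  refine ⟨Nat.sInf_le ⟨Nat.succ_pos _, admissible_maxDepth W⟩, embedding (fun n => e n),
    fun u v => ⟨?_, hlip u v⟩, heq⟩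
  by_cases h : UpDown u v
  · rw [heq u v h]
    refine mul_le_of_le_one_left (Nat.cast_nonneg _) ?_
    rw [div_le_one (by positivity)]
    exact one_le_pow₀ (by norm_num)
  · exact dist_le_two_pow_mul_norm hW_bot hW_top he hlin hp h
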